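/- \textbf{Theorem.} In $\mathsf{RCA}_0$ (the system of second-order arithmetic with the basic axioms for $0,1,+,\cdot,<$, induction for $\Sigma^0_1$ formulas and comprehension for $\Delta^0_1$ formulas, with number and set parameters) the following is provable; equivalently, by the completeness theorem, it holds in every model $(M,S)$ of $\mathsf{RCA}_0$, with number quantifiers ranging over $M$ and set quantifiers over $S\subseteq\mathcal P(M)$. For every natural number $k$ the following are equivalent: \begin{enumerate} \item ($H$-closure Theorem for $k$ relations) for all binary relations $R_0,\dots,R_{k-1}$ on $\mathbb N$, if every $R_i$ with $i<k$ is inductively $H$-well-founded, then $R_0\cup\dots\cup R_{k-1}$ is inductively $H$-well-founded; \item for all binary relations $R_0,\dots,R_{k-1}$ on $\mathbb N$, if every $R_i$ with $i<k$ is $H$-well-founded, then $R_0\cup\dots\cup R_{k-1}$ is $H$-well-founded; \item $\mathsf{RT}^2_k$: for every $P:[\mathbb N]^2\to k$ there is an infinite set $H\subseteq\mathbb N$ such that $P$ is constant on $[H]^2$, where $[X]^2$ is the set of two-element subsets of $X$. \end{enumerate} Here $k$ is a number variable of $\mathsf{RCA}_0$ (so it ranges over $M$, and every standard $k$ is included),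 and a sequence $R_0,\dots,R_{k-1}$ of relations is given by one set. For a binary relation $R$ on $\mathbb N$, $H(R)$ is the set of (codes of) finite sequences $\langle x_0,\dots,x_{n-1}\rangle$, $n\ge 0$, such that $x_j\,R\,x_i$ whenever $i<j<n$. For finite sequences, $t\succ s$ means that $t$ extends $s$ by exactly one entry. $R$ is \emph{$H$-well-founded} if there is no function $f:\mathbb N\to H(R)$ with $f(n+1)\succ f(n)$ for all $n$. $R$ is \emph{inductively $H$-well-founded} if every set $X$ such that, for all $s\in H(R)$, $\bigl(\forall t\in H(R)\,(t\succ s\Rightarrow t\in X)\bigr)\Rightarrow s\in X$, contains every element of $H(R)$. -/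

import Mathlib

/-!
# Second-order arithmetic, the system RCA₀, and H-well-foundedness

A structure for the language of second-order arithmetic is a type `M` (the numbers) with
`0, 1, +, *, <` and a collection `S : Set (Set M)` (the sets). The interpretation of a statement
of second-order arithmetic in `(M, S)` lets its number quantifiers range over `M` and its set
quantifiers over `S`; the predicates below are all written in this way. No law is
assumed of `M` and `S` before `ModelsRCA0`.
-/

namespace SOA

universe u

/-! ### Syntax: numerical terms and bounded quantifier formulas -/

/-- Numerical terms; number variables are de Bruijn indices. -/
inductive NumTerm : Type
  | var (i : ℕ)
  | zero
  | one
  | add (t₁ t₂ : NumTerm)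
  | mul (t₁ t₂ : NumTerm)

/-- Formulas with bounded number quantifiers and no set quantifiers (`Σ⁰₀` formulas). Free set
variables are allowed. `ball t φ` is `∀ x < t, φ`, where `x` is the variable `0` of `φ` and does
not occur in `t`. The remaining connectives and `∃ x < t` are definable from those given. -/
inductive BddFormula : Type
  | eq (t₁ t₂ : NumTerm)
  | lt (t₁ t₂ : NumTerm)
  | mem (t : NumTerm) (X : ℕ)
  | neg (φ : BddFormula)
  | and (φ ψ : BddFormula)
  | ball (t : NumTerm) (φ : BddFormula)

section Semantics

variable {M : Type u} [Zero M] [One M] [Add M] [Mul M] [LT M]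

/-- The valuation that gives the value `a` to variable `0` and `v i` to variable `i + 1`. -/
def push (a : M) (v : ℕ → M) : ℕ → M
  | 0 => a
  | i + 1 => v i

/-- The value of a term. -/
def NumTerm.val (v : ℕ → M) : NumTerm → M
  | .var i => v i
  | .zero => 0
  | .one => 1
  | .add t₁ t₂ => t₁.val v + t₂.val v
  | .mul t₁ t₂ => t₁.val v * t₂.val v

/-- Truth of a bounded quantifier formula under a valuation `v` of the number variables and a
valuation `V` of the set variables. -/
def BddFormula.Holds (V : ℕ → Set M) : BddFormula → (ℕ → M) → Prop
  | .eq t₁ t₂, v => t₁.val v = t₂.val v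
  | .lt t₁ t₂, v => t₁.val v < t₂.val v
  | .mem t X, v => t.val v ∈ V X
  | .neg φ, v => ¬ φ.Holds V v
  | .and φ ψ, v => φ.Holds V v ∧ ψ.Holds V v
  | .ball t φ, v => ∀ a : M, a < t.val v → φ.Holds V (push a v)

/-! ### The system RCA₀ -/

/-- `(M, S)` is a model of RCA₀: the basic axioms, induction for `Σ⁰₁` formulas and comprehension
for `Δ⁰₁` formulas, both with arbitrary number parameters `v` and set parameters `V`. A `Σ⁰₁`
(`Π⁰₁`) formula in the number variable `n` is `∃ m, θ(n, m)` (`∀ m, θ(n, m)`) with `θ` a bounded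
quantifier formula, in which `m` is the variable `0` and `n` is the variable `1`. -/
structure ModelsRCA0 (S : Set (Set M)) : Prop where
  /-- as usual in logic, the domain of the set variables is not empty -/
  sets_nonempty : S.Nonempty
  succ_ne_zero : ∀ n : M, n + 1 ≠ 0
  succ_inj : ∀ m n : M, m + 1 = n + 1 → m = n
  add_zero : ∀ m : M, m + 0 = m
  add_succ : ∀ m n : M, m + (n + 1) = (m + n) + 1
  mul_zero : ∀ m : M, m * 0 = 0
  mul_succ : ∀ m n : M, m * (n + 1) = m * n + m
  not_lt_zero : ∀ m : M, ¬ m < 0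
  lt_succ : ∀ m n : M, m < n + 1 ↔ m < n ∨ m = n
  sigma_induction : ∀ (θ : BddFormula) (v : ℕ → M) (V : ℕ → Set M), (∀ i, V i ∈ S) →
    (∃ m : M, θ.Holds V (push m (push 0 v))) →
    (∀ n : M, (∃ m : M, θ.Holds V (push m (push n v))) →
      ∃ m : M, θ.Holds V (push m (push (n + 1) v))) →
    ∀ n : M, ∃ m : M, θ.Holds V (push m (push n v))
  delta_comprehension : ∀ (θ ψ : BddFormula) (v : ℕ → M) (V : ℕ → Set M), (∀ i, V i ∈ S) →
    (∀ n : M, (∃ m : M, θ.Holds V (push m (push n v))) ↔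
      ∀ m : M, ψ.Holds V (push m (push n v))) →
    ∃ X ∈ S, ∀ n : M, n ∈ X ↔ ∃ m : M, θ.Holds V (push m (push n v))

/-! ### Codes for pairs, finite sets and finite sequences -/

/-- The code `(i + j)² + i` of the pair `(i, j)`. -/
def pair (i j : M) : M := (i + j) * (i + j) + i

/-- `i` belongs to the finite set described by the number `c`: if `c = (k, (m, n))`, this is the
set of all `i < k` such that `m * (i + 1) + 1` divides `n`. -/
def FinMem (c i : M) : Prop :=
  ∃ k m n : M, c = pair k (pair m n) ∧ i < k ∧ ∃ q : M, n = (m * (i + 1) + 1) * q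

/-- `c` is the code of a finite set, that is, the least number that describes this set. -/
def IsFinSetCode (c : M) : Prop :=
  ∀ c' : M, c' < c → ¬ ∀ i : M, FinMem c' i ↔ FinMem c i

/-- The finite sequence coded by `s` has `x` as its entry of index `i`. -/
def Entry (s i x : M) : Prop := FinMem s (pair i x)

/-- `s` is the code of a finite sequence of length `l`: it codes a finite set of pairs which is
(the graph of) a function on the numbers less than `l`. -/
def IsSeq (s l : M) : Prop :=
  IsFinSetCode s ∧
  (∀ p : M, FinMem s p → ∃ i x : M, i < l ∧ p = pair i x) ∧
  ∀ i : M, i < l → ∃! x : M, Entry s i x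

/-- One-step expansion `t ≻ s` of (codes of) finite sequences: `t` is one entry longer than `s`,
and has the same entries as `s` at all the indices of `s`. -/
def Expands (t s : M) : Prop :=
  ∃ l : M, IsSeq s l ∧ IsSeq t (l + 1) ∧
    ∀ i : M, i < l → ∀ x : M, Entry t i x ↔ Entry s i x

/-! ### H-well-foundedness

A binary relation `r` on the numbers is given by a formula; here `r y x` reads `y R x`, that is,
`y` is below `x`. -/

/-- `s ∈ H(R)`: `s` codes a finite sequence `⟨x₀, …, x_{l-1}⟩` with `x_j R x_i` whenever
`i < j < l`. -/
def MemH (r : M → M → Prop) (s : M) : Prop :=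
  ∃ l : M, IsSeq s l ∧
    ∀ i j x y : M, i < j → j < l → Entry s i x → Entry s j y → r y x

/-- `R` is inductively H-well-founded: every set that is inductive for `≻` on `H(R)`
contains all of `H(R)`. -/
def IndHWellFounded (S : Set (Set M)) (r : M → M → Prop) : Prop :=
  ∀ X ∈ S,
    (∀ s : M, MemH r s → (∀ t : M, MemH r t → Expands t s → t ∈ X) → s ∈ X) →
    ∀ s : M, MemH r s → s ∈ X

/-- `F` is (the graph of) a function from numbers to numbers. -/
def IsFun (F : Set M) : Prop :=
  (∀ p ∈ F, ∃ n x : M, p = pair n x) ∧ ∀ n : M, ∃! x : M, pair n x ∈ F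

/-- `R` is (classically) H-well-founded: there is no function `f` with values in
`H(R)` and `f (n + 1) ≻ f n` for all `n`. -/
def HWellFounded (S : Set (Set M)) (r : M → M → Prop) : Prop :=
  ¬ ∃ F ∈ S, IsFun F ∧
    (∀ n s : M, pair n s ∈ F → MemH r s) ∧
    ∀ n s t : M, pair n s ∈ F → pair (n + 1) t ∈ F → Expands t s

/-! ### The three principles -/

/-- The relation `R i` of the sequence of binary relations coded by the set `R`. -/
def relAt (R : Set M) (i : M) : M → M → Prop := fun y x => pair (pair y x) i ∈ R

/-- The union of the relations `R i`, `i < k`. -/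
def unionRel (R : Set M) (k : M) : M → M → Prop := fun y x => ∃ i : M, i < k ∧ relAt R i y x

/-- H-closure for `k` relations: a union of `k` inductively H-well-founded relations is
inductively H-well-founded. -/
def IndHClosure (S : Set (Set M)) (k : M) : Prop :=
  ∀ R ∈ S, (∀ i : M, i < k → IndHWellFounded S (relAt R i)) → IndHWellFounded S (unionRel R k)

/-- A union of `k` (classically) H-well-founded relations is H-well-founded. -/
def HClosure (S : Set (Set M)) (k : M) : Prop :=
  ∀ R ∈ S, (∀ i : M, i < k → HWellFounded S (relAt R i)) → HWellFounded S (unionRel R k)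

/-- `P` is (the graph of) a colouring of the two-element sets of numbers in `k` colours; the set
with elements `x < y` is represented by the pair `(x, y)`. -/
def IsColouring (P : Set M) (k : M) : Prop :=
  (∀ p ∈ P, ∃ x y c : M, x < y ∧ c < k ∧ p = pair (pair x y) c) ∧
  ∀ x y : M, x < y → ∃! c : M, pair (pair x y) c ∈ P

/-- Ramsey's theorem for pairs in `k` colours: every colouring has an infinite homogeneous set. -/
def RT2 (S : Set (Set M)) (k : M) : Prop :=
  ∀ P ∈ S, IsColouring P k →
    ∃ H ∈ S, (∀ n : M, ∃ m ∈ H, n < m) ∧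
      ∃ c : M, c < k ∧ ∀ x ∈ H, ∀ y ∈ H, x < y → pair (pair x y) c ∈ P

end Semantics

end SOA

/-!
Both equivalences are proved through infinite chains. For a relation `r` of the model, an infinite
branch of `H(r)` is the same as a function `g` of the model with `r (g j) (g i)` for all `i < j`:
the initial segments of `g` form a branch, and the entries of a branch are the values of a chain
(`hWellFounded_iff`). The inductive and the classical form of H-well-foundedness agree for each
single relation (`indHWellFounded_iff`): the complement of a branch is inductive, and outside an
inductive set that omits an element of `H(r)` a branch is found by iterated search. This gives the
equivalence of the two closure statements, since the union of the `R i` is again a relation of the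
model.

Ramsey's theorem follows from H-closure applied to the relations `x < y ∧ P(x, y) = i`
(`RT2.of_hClosure`): their union has the chain `0, 1, 2, …`, so one of them has a chain, and the
values of this chain are a homogeneous set. Conversely (`RT2.hClosure`), a chain for the union
colours each pair by the least relation that holds between its two entries, and along an infinite
homogeneous set it is a chain for one relation.

All of this takes place inside a model that is not assumed to be standard, so that each set and
function used has to be shown to belong to the model and each induction has to be one for a `Σ⁰₁`
formula. After the numbers have been shown to form a discretely ordered semiring (`Numbers`), the
comprehension scheme is applied to a fixed list of formulas, from which the sets of the model
inherit closure properties stated without syntax: `RecP` and `RecF` are the predicates and the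
functions that belong to the model, on all finite powers of `M` at once by means of the bijective
pairing `natPair`. They are closed under composition, bounded quantification, `Δ⁰₁` comprehension
(`RecP.delta`), unbounded search (`exists_recF`) and iteration (`RecF.exists_iterate`), and
`fun_prop` decides membership in practice. Finite sets of numbers are coded with the moduli
`m (i + 1) + 1`, where `m` is a common multiple of the relevant differences
(`exists_finMem_iff`); coprimality is used only in the form that one such modulus can be cancelled
against another (`dvd_of_dvd_mul_modulus`).
-/

namespace SOA

/-! ### The numbers of a model form a discretely ordered semiring -/

section Arithmetic

variable {M : Type*} [Zero M] [One M] [Add M] [Mul M] [LT M] {S : Set (Set M)}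

namespace ModelsRCA0

/-- Induction for bounded formulas, in the form in which the arithmetical laws are derived: the
formula has no set variables, and its dummy number variable `0` is instantiated arbitrarily. -/
theorem bounded_induction (hS : ModelsRCA0 S) {P : M → Prop} (θ : BddFormula) (v : ℕ → M)
    (hP : ∀ V m n, θ.Holds V (push m (push n v)) ↔ P n)
    (h0 : P 0) (hs : ∀ n, P n → P (n + 1)) (n : M) : P n := by
  obtain ⟨X, hX⟩ := hS.sets_nonempty
  have := hS.sigma_induction θ v (fun _ => X) (fun _ => hX)
  simp only [hP, exists_const_iff] at this
  exact (this ⟨⟨0⟩, h0⟩ (fun n h => ⟨h.1, hs n h.2⟩) n).2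

theorem add_assoc (hS : ModelsRCA0 S) (a b c : M) : a + b + c = a + (b + c) := by
  refine hS.bounded_induction (P := fun c => a + b + c = a + (b + c))
    (.eq (.add (.add (.var 2) (.var 3)) (.var 1)) (.add (.var 2) (.add (.var 3) (.var 1))))
    (push a (push b fun _ => a)) (fun _ _ _ => Iff.rfl) ?_ ?_ c
  · rw [hS.add_zero, hS.add_zero]
  · intro n h; rw [hS.add_succ, hS.add_succ, hS.add_succ, h]

theorem zero_add (hS : ModelsRCA0 S) (a : M) : 0 + a = a := by
  refine hS.bounded_induction (P := fun a => 0 + a = a)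
    (.eq (.add .zero (.var 1)) (.var 1)) (fun _ => a) (fun _ _ _ => Iff.rfl) ?_ ?_ a
  · rw [hS.add_zero]
  · intro n h; rw [hS.add_succ, h]

theorem succ_add (hS : ModelsRCA0 S) (a b : M) : a + 1 + b = a + b + 1 := by
  refine hS.bounded_induction (P := fun b => a + 1 + b = a + b + 1)
    (.eq (.add (.add (.var 2) .one) (.var 1)) (.add (.add (.var 2) (.var 1)) .one))
    (fun _ => a) (fun _ _ _ => Iff.rfl) ?_ ?_ b
  · rw [hS.add_zero, hS.add_zero]
  · intro n h; rw [hS.add_succ, hS.add_succ, h]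

theorem add_comm (hS : ModelsRCA0 S) (a b : M) : a + b = b + a := by
  refine hS.bounded_induction (P := fun b => a + b = b + a)
    (.eq (.add (.var 2) (.var 1)) (.add (.var 1) (.var 2)))
    (fun _ => a) (fun _ _ _ => Iff.rfl) ?_ ?_ b
  · rw [hS.add_zero, hS.zero_add]
  · intro n h; rw [hS.add_succ, hS.succ_add, h]

theorem zero_mul (hS : ModelsRCA0 S) (a : M) : 0 * a = 0 := by
  refine hS.bounded_induction (P := fun a => 0 * a = 0)
    (.eq (.mul .zero (.var 1)) .zero) (fun _ => a) (fun _ _ _ => Iff.rfl) ?_ ?_ a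
  · rw [hS.mul_zero]
  · intro n h; rw [hS.mul_succ, h, hS.add_zero]

theorem succ_mul (hS : ModelsRCA0 S) (a b : M) : (a + 1) * b = a * b + b := by
  refine hS.bounded_induction (P := fun b => (a + 1) * b = a * b + b)
    (.eq (.mul (.add (.var 2) .one) (.var 1)) (.add (.mul (.var 2) (.var 1)) (.var 1)))
    (fun _ => a) (fun _ _ _ => Iff.rfl) ?_ ?_ b
  · rw [hS.mul_zero, hS.mul_zero, hS.add_zero]
  · intro n h
    rw [hS.mul_succ, hS.mul_succ, h, hS.add_succ _ a, hS.add_succ _ n, hS.add_assoc _ n a,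
      hS.add_assoc _ a n, hS.add_comm n a]

theorem mul_comm (hS : ModelsRCA0 S) (a b : M) : a * b = b * a := by
  refine hS.bounded_induction (P := fun b => a * b = b * a)
    (.eq (.mul (.var 2) (.var 1)) (.mul (.var 1) (.var 2)))
    (fun _ => a) (fun _ _ _ => Iff.rfl) ?_ ?_ b
  · rw [hS.mul_zero, hS.zero_mul]
  · intro n h; rw [hS.mul_succ, hS.succ_mul, h]

theorem mul_add (hS : ModelsRCA0 S) (a b c : M) : a * (b + c) = a * b + a * c := by
  refine hS.bounded_induction (P := fun c => a * (b + c) = a * b + a * c)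
    (.eq (.mul (.var 2) (.add (.var 3) (.var 1)))
      (.add (.mul (.var 2) (.var 3)) (.mul (.var 2) (.var 1))))
    (push a (push b fun _ => a)) (fun _ _ _ => Iff.rfl) ?_ ?_ c
  · rw [hS.mul_zero, hS.add_zero, hS.add_zero]
  · intro n h; rw [hS.add_succ, hS.mul_succ, h, hS.mul_succ, hS.add_assoc]

theorem mul_assoc (hS : ModelsRCA0 S) (a b c : M) : a * b * c = a * (b * c) := by
  refine hS.bounded_induction (P := fun c => a * b * c = a * (b * c))
    (.eq (.mul (.mul (.var 2) (.var 3)) (.var 1)) (.mul (.var 2) (.mul (.var 3) (.var 1))))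
    (push a (push b fun _ => a)) (fun _ _ _ => Iff.rfl) ?_ ?_ c
  · rw [hS.mul_zero, hS.mul_zero, hS.mul_zero]
  · intro n h; rw [hS.mul_succ, hS.mul_succ, h, hS.mul_add]

theorem mul_one (hS : ModelsRCA0 S) (a : M) : a * 1 = a := by
  rw [← hS.zero_add 1, hS.mul_succ, hS.mul_zero, hS.zero_add]

theorem lt_add_right (hS : ModelsRCA0 S) (a b c : M) (h : a < b) : a < b + c := by
  refine hS.bounded_induction (P := fun c => a < b + c)
    (.lt (.var 2) (.add (.var 3) (.var 1)))
    (push a (push b fun _ => a)) (fun _ _ _ => Iff.rfl) ?_ ?_ c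
  · rwa [hS.add_zero]
  · intro n h; rw [hS.add_succ, hS.lt_succ]; exact Or.inl h

theorem lt_succ_self (hS : ModelsRCA0 S) (a : M) : a < a + 1 :=
  (hS.lt_succ _ _).2 (Or.inr rfl)

theorem lt_trans (hS : ModelsRCA0 S) (a b c : M) (hab : a < b) : b < c → a < c := by
  refine hS.bounded_induction (P := fun c => b < c → a < c)
    (.neg (.and (.lt (.var 3) (.var 1)) (.neg (.lt (.var 2) (.var 1)))))
    (push a (push b fun _ => a)) ?_ ?_ ?_ c
  · intro _ _ n
    simp [BddFormula.Holds, NumTerm.val, push]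
  · exact fun h => absurd h (hS.not_lt_zero _)
  · intro n ih h
    rcases (hS.lt_succ _ _).1 h with h | rfl
    · exact (hS.lt_succ _ _).2 (Or.inl (ih h))
    · exact (hS.lt_succ _ _).2 (Or.inl hab)

theorem succ_ne_self (hS : ModelsRCA0 S) (a : M) : a + 1 ≠ a := by
  refine hS.bounded_induction (P := fun a => a + 1 ≠ a)
    (.neg (.eq (.add (.var 1) .one) (.var 1))) (fun _ => a) (fun _ _ _ => Iff.rfl) ?_ ?_ a
  · exact hS.succ_ne_zero 0
  · exact fun n h e => h (hS.succ_inj _ _ e)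

theorem lt_irrefl (hS : ModelsRCA0 S) (a : M) : ¬ a < a := by
  refine hS.bounded_induction (P := fun a => ¬ a < a)
    (.neg (.lt (.var 1) (.var 1))) (fun _ => a) (fun _ _ _ => Iff.rfl) ?_ ?_ a
  · exact hS.not_lt_zero 0
  · intro n ih h
    rcases (hS.lt_succ _ _).1 h with h | h
    · exact ih (hS.lt_trans _ _ _ (hS.lt_succ_self n) h)
    · exact hS.succ_ne_self n h

theorem eq_zero_or_succ (hS : ModelsRCA0 S) (a : M) : a = 0 ∨ ∃ b, a = b + 1 := by
  by_contra h
  push Not at h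
  refine hS.bounded_induction (P := fun n => a ≠ n)
    (.neg (.eq (.var 2) (.var 1))) (fun _ => a) (fun _ _ _ => Iff.rfl) h.1
    (fun n _ => h.2 n) a rfl

/-- The order is decided by the difference; `∃ m` makes the induction formula a `Σ⁰₁` one. -/
theorem exists_difference (hS : ModelsRCA0 S) (a b : M) :
    ∃ m, ¬ (¬ b = a + (m + 1) ∧ ¬ a = b + m) := by
  obtain ⟨X, hX⟩ := hS.sets_nonempty
  refine hS.sigma_induction
    (.neg (.and (.neg (.eq (.var 1) (.add (.var 2) (.add (.var 0) .one))))
      (.neg (.eq (.var 2) (.add (.var 1) (.var 0)))))) (fun _ => a) (fun _ => X) (fun _ => hX)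
    ?_ ?_ b
  · exact ⟨a, fun h => h.2 (hS.zero_add a).symm⟩
  · rintro n ⟨m, hm⟩
    change ¬ (¬ n = a + (m + 1) ∧ ¬ a = n + m) at hm
    change ∃ m, ¬ (¬ n + 1 = a + (m + 1) ∧ ¬ a = n + 1 + m)
    by_cases h : n = a + (m + 1)
    · exact ⟨m + 1, fun h' => h'.1 (by rw [h, hS.add_succ a (m + 1)])⟩
    · have h2 : a = n + m := by by_contra h2; exact hm ⟨h, h2⟩
      rcases hS.eq_zero_or_succ m with rfl | ⟨m, rfl⟩
      · exact ⟨0, fun h' => h'.1 (by rw [hS.zero_add, h2, hS.add_zero])⟩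
      · exact ⟨m, fun h' => h'.2 (by rw [h2, hS.add_succ, hS.succ_add])⟩

theorem lt_iff (hS : ModelsRCA0 S) (a b : M) : a < b ↔ ∃ c, b = a + (c + 1) := by
  constructor
  · intro h
    obtain ⟨m, hm⟩ := hS.exists_difference a b
    refine ⟨m, ?_⟩
    by_contra hne
    have h2 : a = b + m := by by_contra h2; exact hm ⟨hne, h2⟩
    have := hS.lt_add_right a b m h
    rw [← h2] at this
    exact hS.lt_irrefl a this
  · rintro ⟨c, rfl⟩
    rw [hS.add_comm c 1, ← hS.add_assoc]
    exact hS.lt_add_right _ _ _ (hS.lt_succ_self a)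

theorem lt_or_exists_add (hS : ModelsRCA0 S) (a b : M) : a < b ∨ ∃ m, a = b + m := by
  obtain ⟨m, hm⟩ := hS.exists_difference a b
  by_cases h : b = a + (m + 1)
  · exact Or.inl ((hS.lt_iff a b).2 ⟨m, h⟩)
  · exact Or.inr ⟨m, by by_contra h2; exact hm ⟨h, h2⟩⟩

theorem lt_trichotomy (hS : ModelsRCA0 S) (a b : M) : a < b ∨ a = b ∨ b < a := by
  rcases hS.lt_or_exists_add a b with h | ⟨m, rfl⟩
  · exact Or.inl h
  · rcases hS.eq_zero_or_succ m with rfl | ⟨m, rfl⟩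
    · exact Or.inr (Or.inl (hS.add_zero b))
    · exact Or.inr (Or.inr ((hS.lt_iff _ _).2 ⟨m, rfl⟩))

/-- The numbers of a model as a commutative semiring; the four operations are the given ones. -/
@[reducible] def commSemiring (hS : ModelsRCA0 S) : CommSemiring M where
  add_assoc := hS.add_assoc
  zero_add := hS.zero_add
  add_zero := hS.add_zero
  add_comm := hS.add_comm
  zero_mul := hS.zero_mul
  mul_zero := hS.mul_zero
  mul_assoc := hS.mul_assoc
  mul_comm := hS.mul_comm
  mul_one := hS.mul_one
  one_mul a := by rw [hS.mul_comm, hS.mul_one]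
  left_distrib := hS.mul_add
  right_distrib a b c := by
    rw [hS.mul_comm, hS.mul_add, hS.mul_comm c a, hS.mul_comm c b]
  nsmul := nsmulRec

open Classical in
/-- The given order of the numbers, as a linear order. -/
@[reducible] noncomputable def linearOrder (hS : ModelsRCA0 S) : LinearOrder M where
  le a b := a < b ∨ a = b
  lt a b := a < b
  le_refl a := Or.inr rfl
  le_trans a b c := by
    rintro (h | rfl) (h' | rfl)
    · exact Or.inl (hS.lt_trans _ _ _ h h')
    · exact Or.inl h
    · exact Or.inl h'
    · exact Or.inr rfl
  le_antisymm a b := by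
    rintro (h | rfl) (h' | h')
    · exact absurd (hS.lt_trans _ _ _ h h') (hS.lt_irrefl _)
    · exact h'.symm
    · rfl
    · rfl
  lt_iff_le_not_ge a b := by
    constructor
    · refine fun h => ⟨Or.inl h, ?_⟩
      rintro (h' | rfl)
      · exact hS.lt_irrefl _ (hS.lt_trans _ _ _ h h')
      · exact hS.lt_irrefl _ h
    · rintro ⟨h | rfl, h'⟩
      · exact h
      · exact absurd (Or.inr rfl) h'
  le_total a b := by
    rcases hS.lt_trichotomy a b with h | h | h
    · exact Or.inl (Or.inl h)
    · exact Or.inl (Or.inr h)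
    · exact Or.inr (Or.inl h)
  toDecidableLE := Classical.decRel _

end ModelsRCA0
end Arithmetic

/-- The laws of the numbers of a model of RCA₀ that the rest of the proof uses: a discretely
ordered commutative semiring, with `a ≤ b` exactly if `b` is the sum of `a` and some number. -/
class Numbers (M : Type*) extends CommSemiring M, LinearOrder M, IsStrictOrderedRing M,
  CanonicallyOrderedAdd M, SuccAddOrder M

/-- The numbers of a model of RCA₀, with the given operations and the given order. -/
@[reducible] noncomputable def ModelsRCA0.numbers {M : Type*} [Zero M] [One M] [Add M] [Mul M]
    [LT M] {S : Set (Set M)} (hS : ModelsRCA0 S) : Numbers M :=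
  letI := hS.commSemiring
  letI := hS.linearOrder
  have add_lt : ∀ a b c : M, a < b → c + a < c + b := by
    intro a b c h
    obtain ⟨d, rfl⟩ := (hS.lt_iff a b).1 h
    exact (hS.lt_iff _ _).2 ⟨d, by rw [hS.add_assoc]⟩
  have le_add : ∀ a b : M, a ≤ a + b := by
    intro a b
    rcases hS.eq_zero_or_succ b with rfl | ⟨b, rfl⟩
    · exact Or.inr (hS.add_zero a).symm
    · exact Or.inl ((hS.lt_iff _ _).2 ⟨b, rfl⟩)
  have mul_lt : ∀ a b c : M, a < b → 0 < c → a * c < b * c := by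
    intro a b c h hc
    obtain ⟨d, rfl⟩ := (hS.lt_iff a b).1 h
    obtain ⟨e, rfl⟩ := (hS.lt_iff 0 c).1 hc
    refine (hS.lt_iff _ _).2 ⟨d * (e + 1) + e, ?_⟩
    rw [hS.zero_add]
    ring
  have le_of : ∀ a b : M, a ≤ b → ∃ c, b = a + c := by
    rintro a b (h | rfl)
    · obtain ⟨d, rfl⟩ := (hS.lt_iff a b).1 h
      exact ⟨_, rfl⟩
    · exact ⟨0, (hS.add_zero a).symm⟩
  { hS.commSemiring, hS.linearOrder with
    add_le_add_left := by
      rintro a b (h | rfl) c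
      · rw [hS.add_comm a, hS.add_comm b]; exact Or.inl (add_lt _ _ _ h)
      · exact le_rfl
    le_of_add_le_add_left := by
      intro a b c h
      by_contra h'
      exact absurd h (not_le.2 (add_lt _ _ _ (not_le.1 h')))
    zero_le_one := by rw [← hS.zero_add 1]; exact le_add 0 1
    mul_lt_mul_of_pos_left := by
      intro a ha b c hbc
      have := mul_lt b c a hbc ha
      rwa [hS.mul_comm b, hS.mul_comm c] at this
    mul_lt_mul_of_pos_right := by
      intro a ha b c hbc
      exact mul_lt b c a hbc ha
    exists_pair_ne := ⟨0, 1, fun h => hS.succ_ne_zero 0 (by rw [hS.zero_add, h])⟩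
    exists_add_of_le := fun {a b} h => le_of a b h
    le_add_self := by intro a b; rw [hS.add_comm]; exact le_add _ _
    le_self_add := le_add
    succ := fun a => a + 1
    le_succ := fun a => le_add a 1
    max_of_succ_le := fun {a} h => absurd (hS.lt_succ_self a) (not_lt.2 h)
    succ_le_of_lt := by
      intro a b h
      obtain ⟨d, rfl⟩ := (hS.lt_iff a b).1 h
      rw [hS.add_comm d 1, ← hS.add_assoc]
      exact le_add _ _
    succ_eq_add_one := fun _ => rfl }

/-! ### A bijective pairing function -/

/-- A collection of sets that is the second-order part of a model of RCA₀ whose first-order part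
is the given ordered semiring. -/
class RCA0 {M : Type*} [Numbers M] (S : Set (Set M)) : Prop where
  models : ModelsRCA0 S

section Pairing

variable {M : Type*} [Numbers M]

open Classical in
/-- A pairing function that, unlike `pair`, is onto: it enumerates the pairs by their maximum. -/
noncomputable def natPair (a b : M) : M := if a < b then b * b + a else a * a + a + b

theorem sq_succ (s : M) : (s + 1) * (s + 1) = s * s + (s + s) + 1 := by ring

/-- A number has at most one integer square root. -/
theorem sqrt_unique {s t n : M} (h1 : s * s ≤ n) (h2 : n < (s + 1) * (s + 1)) (h3 : t * t ≤ n)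
    (h4 : n < (t + 1) * (t + 1)) : s = t := by
  have : ∀ s t n : M, s * s ≤ n → n < (t + 1) * (t + 1) → s ≤ t := by
    intro s t n h1 h2
    by_contra h3
    have h4 : t + 1 ≤ s := Order.add_one_le_of_lt (not_le.1 h3)
    exact absurd (h2.trans_le ((mul_le_mul' h4 h4).trans h1)) (lt_irrefl _)
  exact le_antisymm (this s t n h1 h4) (this t s n h3 h2)

theorem natPair_injective {a b c d : M} (h : natPair a b = natPair c d) : a = c ∧ b = d := by
  -- the maximum of the pair is the integer square root of its code
  have bounds : ∀ a b : M, max a b * max a b ≤ natPair a b ∧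
      natPair a b < (max a b + 1) * (max a b + 1) := by
    intro a b
    unfold natPair
    split_ifs with h
    · rw [max_eq_right h.le, sq_succ]
      refine ⟨le_self_add, ?_⟩
      have : (0 : M) ≤ b := zero_le
      rw [Order.lt_add_one_iff]
      grind
    · rw [max_eq_left (not_lt.1 h), sq_succ]
      refine ⟨le_self_add.trans le_self_add, ?_⟩
      rw [Order.lt_add_one_iff]
      grind
  have hm : max a b = max c d :=
    sqrt_unique (bounds a b).1 (bounds a b).2 (h ▸ (bounds c d).1) (h ▸ (bounds c d).2)
  unfold natPair at h
  split_ifs at h with h1 h2 h2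
  · rw [max_eq_right h1.le, max_eq_right h2.le] at hm
    grind
  · rw [max_eq_right h1.le, max_eq_left (not_lt.1 h2)] at hm
    have : (0 : M) ≤ d := zero_le
    grind
  · rw [max_eq_left (not_lt.1 h1), max_eq_right h2.le] at hm
    have : (0 : M) ≤ b := zero_le
    grind
  · rw [max_eq_left (not_lt.1 h1), max_eq_left (not_lt.1 h2)] at hm
    grind

theorem le_natPair_left (a b : M) : a ≤ natPair a b := by
  unfold natPair; split_ifs
  · exact le_add_self
  · rw [add_right_comm]; exact le_add_self

theorem le_natPair_right (a b : M) : b ≤ natPair a b := by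
  unfold natPair; split_ifs with h
  · have h2 : 1 ≤ b := Order.one_le_iff_pos.2 ((zero_le (a := a)).trans_lt h)
    exact (le_mul_of_one_le_right' h2).trans le_self_add
  · exact le_add_self

theorem exists_natPair {S : Set (Set M)} (hS : RCA0 S) (n : M) : ∃ a b, natPair a b = n := by
  have hsq : ∃ s : M, s * s ≤ n ∧ n < (s + 1) * (s + 1) := by
    obtain ⟨X, hX⟩ := hS.models.sets_nonempty
    have := hS.models.sigma_induction
      (.and (.lt (.mul (.var 0) (.var 0)) (.add (.var 1) .one))
        (.lt (.var 1) (.mul (.add (.var 0) .one) (.add (.var 0) .one))))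
      (fun _ => 0) (fun _ => X) (fun _ => hX)
    simp only [BddFormula.Holds, NumTerm.val, push, Order.lt_add_one_iff] at this
    refine this ⟨0, by simp, by simp⟩ ?_ n
    rintro n ⟨s, h1, h2⟩
    rcases (Order.add_one_le_of_lt h2).eq_or_lt with h | h
    · refine ⟨s + 1, h.ge, ?_⟩
      have : (0 : M) ≤ s := zero_le
      rw [h, sq_succ (s + 1), Order.lt_add_one_iff]
      grind
    · exact ⟨s, h1.trans le_self_add, h⟩
  obtain ⟨s, h1, h2⟩ := hsq
  obtain ⟨r, rfl⟩ := exists_add_of_le h1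
  rcases lt_or_ge r s with h | h
  · exact ⟨r, s, by rw [natPair, if_pos h]⟩
  · obtain ⟨t, rfl⟩ := exists_add_of_le h
    have h3 : ¬ s < t := by rw [sq_succ] at h2; grind [Order.lt_add_one_iff]
    exact ⟨s, t, by rw [natPair, if_neg h3]; ring⟩

/-- The equivalence of pairs of numbers and numbers given by `natPair`; the model `S` serves to
prove that it is onto. -/
noncomputable def natPairEquiv (S : Set (Set M)) [hS : RCA0 S] : M × M ≃ M :=
  Equiv.ofBijective (fun p => natPair p.1 p.2)
    ⟨fun _ _ h => Prod.ext (natPair_injective h).1 (natPair_injective h).2,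
      fun n => let ⟨a, b, h⟩ := exists_natPair hS n; ⟨(a, b), h⟩⟩

end Pairing

/-! ### Closure properties of the sets of a model -/

section Closure

variable {M : Type*} [Numbers M] {S : Set (Set M)} [hS : RCA0 S]

variable (S) in
/-- First component of the pair coded by a number. -/
noncomputable def left (n : M) : M := ((natPairEquiv S).symm n).1

variable (S) in
/-- Second component of the pair coded by a number. -/
noncomputable def right (n : M) : M := ((natPairEquiv S).symm n).2

@[simp] theorem natPair_left_right (n : M) : natPair (left S n) (right S n) = n :=
  (natPairEquiv S).apply_symm_apply n

@[simp] theorem left_natPair (a b : M) : left S (natPair a b) = a :=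
  congrArg Prod.fst ((natPairEquiv S).symm_apply_apply (a, b))

@[simp] theorem right_natPair (a b : M) : right S (natPair a b) = b :=
  congrArg Prod.snd ((natPairEquiv S).symm_apply_apply (a, b))

namespace BddFormula

/-- The formula `(t₁, t₂) ∈ X`, for the pairing function `natPair`. -/
def memPair (t₁ t₂ : NumTerm) (X : ℕ) : BddFormula :=
  .neg (.and (.neg (.and (.lt t₁ t₂) (.mem (.add (.mul t₂ t₂) t₁) X)))
    (.neg (.and (.neg (.lt t₁ t₂)) (.mem (.add (.add (.mul t₁ t₁) t₁) t₂) X))))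

/-- The formula `(t₁, t₂) = t₃`, for the pairing function `natPair`. -/
def pairEq (t₁ t₂ t₃ : NumTerm) : BddFormula :=
  .neg (.and (.neg (.and (.lt t₁ t₂) (.eq (.add (.mul t₂ t₂) t₁) t₃)))
    (.neg (.and (.neg (.lt t₁ t₂)) (.eq (.add (.add (.mul t₁ t₁) t₁) t₂) t₃))))

/-- The formula that says `θ` of the pair coded by the variable `i`: its second component is
the variable `0` of `θ` and its first component the variable `1`. -/
def unpair (i : ℕ) (θ : BddFormula) : BddFormula :=
  .ball (.add (.var i) .one) (.ball (.add (.var (i + 1)) .one)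
    (.neg (.and (pairEq (.var 1) (.var 0) (.var (i + 2))) (.neg θ))))

@[simp] theorem holds_memPair (t₁ t₂ : NumTerm) (X : ℕ) (V : ℕ → Set M) (v : ℕ → M) :
    (memPair t₁ t₂ X).Holds V v ↔ natPair (t₁.val v) (t₂.val v) ∈ V X := by
  by_cases h : t₁.val v < t₂.val v <;> simp [memPair, Holds, natPair, NumTerm.val, h]

@[simp] theorem holds_pairEq (t₁ t₂ t₃ : NumTerm) (V : ℕ → Set M) (v : ℕ → M) :
    (pairEq t₁ t₂ t₃).Holds V v ↔ natPair (t₁.val v) (t₂.val v) = t₃.val v := by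
  by_cases h : t₁.val v < t₂.val v <;> simp [pairEq, Holds, natPair, NumTerm.val, h]

variable (S) in
theorem holds_unpair (i : ℕ) (θ : BddFormula) (V : ℕ → Set M) (v : ℕ → M) :
    (unpair i θ).Holds V v ↔
      θ.Holds V (push (right S (v i)) (push (left S (v i)) v)) := by
  simp only [unpair, Holds, holds_pairEq, NumTerm.val, push, Order.lt_add_one_iff, not_and,
    not_not]
  constructor
  · intro h
    refine h _ ?_ _ ?_ (natPair_left_right _)
    · conv_rhs => rw [← natPair_left_right (S := S) (v i)]
      exact le_natPair_left _ _
    · conv_rhs => rw [← natPair_left_right (S := S) (v i)]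
      exact le_natPair_right _ _
  · rintro h a _ b _ hab
    rw [← hab, left_natPair, right_natPair] at h
    exact h

end BddFormula

open BddFormula

/-- Comprehension for bounded formulas. -/
theorem bounded_comprehension {P : M → Prop} (θ : BddFormula) (v : ℕ → M) (V : ℕ → Set M)
    (hV : ∀ i, V i ∈ S) (h : ∀ m n, θ.Holds V (push m (push n v)) ↔ P n) :
    {n | P n} ∈ S := by
  obtain ⟨X, hX, hXP⟩ := hS.models.delta_comprehension θ θ v V hV (by simp [h])
  convert hX using 1
  ext n
  simp [hXP, h]

theorem compl_mem {A : Set M} (hA : A ∈ S) : Aᶜ ∈ S :=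
  bounded_comprehension (.neg (.mem (.var 1) 0)) (fun _ => 0) (fun _ => A) (fun _ => hA)
    (fun _ _ => Iff.rfl)

/-- The valuation of the set variables by `A` and `B` used for formulas with two parameters. -/
def setVal (A B : Set M) : ℕ → Set M
  | 0 => A
  | _ + 1 => B

theorem setVal_mem {M : Type*} {S : Set (Set M)} {A B : Set M} (hA : A ∈ S)
    (hB : B ∈ S) : ∀ i, setVal A B i ∈ S
  | 0 => hA
  | _ + 1 => hB

theorem inter_mem {A B : Set M} (hA : A ∈ S) (hB : B ∈ S) : A ∩ B ∈ S :=
  bounded_comprehension (.and (.mem (.var 1) 0) (.mem (.var 1) 1)) (fun _ => 0) (setVal A B)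
    (setVal_mem hA hB) (fun _ _ => Iff.rfl)

/-- Comprehension for `Δ⁰₁` formulas, in terms of sets. -/
theorem exists_mem_of_delta {A B : Set M} (hA : A ∈ S) (hB : B ∈ S)
    (h : ∀ n, (∃ m, natPair n m ∈ A) ↔ ∀ m, natPair n m ∈ B) :
    {n | ∃ m, natPair n m ∈ A} ∈ S := by
  obtain ⟨X, hX, hXP⟩ := hS.models.delta_comprehension (memPair (.var 1) (.var 0) 0)
    (memPair (.var 1) (.var 0) 1) (fun _ => 0) (setVal A B) (setVal_mem hA hB)
    (by simpa [NumTerm.val, push, setVal] using h)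
  convert hX using 1
  ext n
  simp [hXP, NumTerm.val, push, setVal]

/-- Induction for `Σ⁰₁` formulas, in terms of sets. -/
theorem induction_of_mem {A : Set M} (hA : A ∈ S) (h0 : ∃ m, natPair 0 m ∈ A)
    (hs : ∀ n, (∃ m, natPair n m ∈ A) → ∃ m, natPair (n + 1) m ∈ A) (n : M) :
    ∃ m, natPair n m ∈ A := by
  have := hS.models.sigma_induction (memPair (.var 1) (.var 0) 0) (fun _ => 0) (fun _ => A)
    (fun _ => hA)
  simp only [holds_memPair, NumTerm.val, push] at this
  exact this h0 hs n

theorem right_mem {A : Set M} (hA : A ∈ S) : {n | right S n ∈ A} ∈ S :=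
  bounded_comprehension (unpair 1 (.mem (.var 0) 0)) (fun _ => 0) (fun _ => A) (fun _ => hA)
    (fun _ _ => by rw [holds_unpair S]; rfl)

theorem natPair_left_left_right_mem {A : Set M} (hA : A ∈ S) :
    {n | natPair (left S (left S n)) (right S n) ∈ A} ∈ S :=
  bounded_comprehension (unpair 1 (unpair 1 (memPair (.var 1) (.var 2) 0))) (fun _ => 0)
    (fun _ => A) (fun _ => hA)
    (fun _ _ => by rw [holds_unpair S, holds_unpair S, holds_memPair]; rfl)

theorem forall_lt_mem {A : Set M} (hA : A ∈ S) :
    {n | ∀ x, x < right S n → natPair (left S n) x ∈ A} ∈ S :=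
  bounded_comprehension (unpair 1 (.ball (.var 0) (memPair (.var 2) (.var 0) 0))) (fun _ => 0)
    (fun _ => A) (fun _ => hA)
    (fun _ _ => by rw [holds_unpair S]; simp [Holds, NumTerm.val, push])

variable (S) in
theorem lt_mem : {n | left S n < right S n} ∈ S := by
  obtain ⟨X, hX⟩ := hS.models.sets_nonempty
  exact bounded_comprehension (unpair 1 (.lt (.var 1) (.var 0))) (fun _ => 0)
    (fun _ => X) (fun _ => hX) (fun _ _ => by rw [holds_unpair S]; rfl)

variable (S) in
/-- A function from numbers to numbers that belongs to the model, by its graph. -/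
def IsRec (F : M → M) : Prop := {n | F (left S n) = right S n} ∈ S

theorem IsRec.mem {F : M → M} (hF : IsRec S F) {A : Set M} (hA : A ∈ S) : {n | F n ∈ A} ∈ S := by
  have h1 : {n | F (left S n) = right S n} ∩ {n | right S n ∈ A} ∈ S :=
    inter_mem hF (right_mem hA)
  have h2 : ({n | F (left S n) = right S n} ∩ {n | right S n ∈ A}ᶜ)ᶜ ∈ S :=
    compl_mem (inter_mem hF (compl_mem (right_mem hA)))
  simpa using exists_mem_of_delta h1 h2 (by simp)

variable (S) in
/-- The functions given by a formula for their graph; the formula has no set variables. -/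
theorem IsRec.of_formula {F : M → M} (θ : BddFormula) (v : ℕ → M)
    (h : ∀ V m n, θ.Holds V (push m (push n v)) ↔ F (left S n) = right S n) : IsRec S F := by
  obtain ⟨X, hX⟩ := hS.models.sets_nonempty
  exact bounded_comprehension θ v (fun _ => X) (fun _ => hX) (h _)

variable (S) in
theorem isRec_id : IsRec S (fun n : M => n) :=
  .of_formula S (unpair 1 (.eq (.var 1) (.var 0))) (fun _ => 0)
    (fun _ _ _ => by rw [holds_unpair S]; rfl)

variable (S) in
theorem isRec_const (c : M) : IsRec S (fun _ => c) :=
  .of_formula S (unpair 1 (.eq (.var 4) (.var 0))) (fun _ => c)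
    (fun _ _ _ => by rw [holds_unpair S]; rfl)

variable (S) in
theorem isRec_left : IsRec S (left S) :=
  .of_formula S (unpair 1 (unpair 1 (.eq (.var 1) (.var 2)))) (fun _ => 0)
    (fun _ _ _ => by rw [holds_unpair S, holds_unpair S]; rfl)

variable (S) in
theorem isRec_right : IsRec S (right S) :=
  .of_formula S (unpair 1 (unpair 1 (.eq (.var 0) (.var 2)))) (fun _ => 0)
    (fun _ _ _ => by rw [holds_unpair S, holds_unpair S]; rfl)

variable (S) in
theorem isRec_add : IsRec S (fun n => left S n + right S n) :=
  .of_formula S (unpair 1 (unpair 1 (.eq (.add (.var 1) (.var 0)) (.var 2)))) (fun _ => 0)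
    (fun _ _ _ => by rw [holds_unpair S, holds_unpair S]; rfl)

variable (S) in
theorem isRec_mul : IsRec S (fun n => left S n * right S n) :=
  .of_formula S (unpair 1 (unpair 1 (.eq (.mul (.var 1) (.var 0)) (.var 2)))) (fun _ => 0)
    (fun _ _ _ => by rw [holds_unpair S, holds_unpair S]; rfl)

theorem IsRec.natPair {F G : M → M} (hF : IsRec S F) (hG : IsRec S G) :
    IsRec S (fun n => natPair (F n) (G n)) := by
  have h1 : {n | F (left S n) = left S (right S n)} ∈ S := by
    have := bounded_comprehension (S := S)
      (P := fun n => SOA.natPair (left S n) (left S (right S n)) ∈ {n | F (left S n) = right S n})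
      (unpair 1 (unpair 0 (memPair (.var 3) (.var 1) 0))) (fun _ => 0) (fun _ => _) (fun _ => hF)
      (fun _ _ => by rw [holds_unpair S, holds_unpair S, holds_memPair]; rfl)
    simpa using this
  have h2 : {n | G (left S n) = right S (right S n)} ∈ S := by
    have := bounded_comprehension (S := S)
      (P := fun n => SOA.natPair (left S n) (right S (right S n)) ∈ {n | G (left S n) = right S n})
      (unpair 1 (unpair 0 (memPair (.var 3) (.var 0) 0))) (fun _ => 0) (fun _ => _) (fun _ => hG)
      (fun _ _ => by rw [holds_unpair S, holds_unpair S, holds_memPair]; rfl)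
    simpa using this
  have h3 := inter_mem h1 h2
  have key : ∀ a b n : M, SOA.natPair a b = n ↔ a = left S n ∧ b = right S n := by
    intro a b n
    constructor
    · rintro rfl; simp
    · rintro ⟨rfl, rfl⟩; simp
  unfold IsRec
  simp only [key]
  exact h3

theorem IsRec.comp {F G : M → M} (hG : IsRec S G) (hF : IsRec S F) :
    IsRec S (fun n => G (F n)) := by
  have h1 : IsRec S (fun n => F (left S n)) := by
    simpa [IsRec] using natPair_left_left_right_mem hF
  simpa [IsRec] using (h1.natPair (isRec_right S)).mem hG

end Closure

/-! ### Recursive predicates and functions -/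

section Recursive

variable {M : Type*} [Numbers M]

/-- A type whose elements are in bijection with the numbers of the model `S`; in use are the
finite powers of `M`. -/
class Coded (S : Set (Set M)) (α : Type*) where
  code : α ≃ M

instance (S : Set (Set M)) : Coded S M := ⟨Equiv.refl M⟩

variable {α β γ : Type*}

noncomputable instance (S : Set (Set M)) [RCA0 S] [Coded S α] [Coded S β] : Coded S (α × β) :=
  ⟨(Equiv.prodCongr (Coded.code S) (Coded.code S)).trans (natPairEquiv S)⟩

open Coded (code)

/-- A predicate that is a set of the model, up to coding. In the standard model of computable
sets these are the recursive predicates, and in general they are closed under everything that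
`Δ⁰₁` comprehension allows. -/
@[fun_prop]
def RecP (S : Set (Set M)) [Coded S α] (P : α → Prop) : Prop := {n : M | P ((code S).symm n)} ∈ S

/-- A function that belongs to the model, up to coding. -/
@[fun_prop]
def RecF (S : Set (Set M)) [hS : RCA0 S] [Coded S α] [Coded S β] (f : α → β) : Prop :=
  IsRec S fun n : M => code S (f ((code S).symm n))

variable {S : Set (Set M)} [hS : RCA0 S] [Coded S α] [Coded S β] [Coded S γ]

@[simp] theorem code_self {M : Type*} {S : Set (Set M)} (a : M) : code S a = a := rfl

@[simp] theorem code_self_symm {M : Type*} {S : Set (Set M)} (a : M) :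
    (code S (α := M)).symm a = a := rfl

@[simp] theorem code_prod (p : α × β) : code S p = natPair (code S p.1) (code S p.2) := rfl

@[simp] theorem code_prod_symm (n : M) : (code S (α := α × β)).symm n =
    ((code S).symm (left S n), (code S).symm (right S n)) := rfl

namespace RecF

variable (S) in
@[fun_prop] theorem id : RecF S (fun a : α => a) := by
  simpa [RecF] using isRec_id S

variable (S) in
@[fun_prop] theorem const (b : β) : RecF S (fun _ : α => b) := isRec_const S _

@[fun_prop] theorem comp {g : β → γ} {f : α → β} (hg : RecF S g) (hf : RecF S f) :
    RecF S (fun a => g (f a)) := by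
  simpa [RecF] using IsRec.comp hg hf

@[fun_prop] theorem prodMk {f : α → β} {g : α → γ} (hf : RecF S f) (hg : RecF S g) :
    RecF S (fun a => (f a, g a)) :=
  IsRec.natPair hf hg

@[fun_prop] theorem fst {f : α → β × γ} (hf : RecF S f) : RecF S (fun a => (f a).1) := by
  have : RecF S (Prod.fst : β × γ → β) := by simpa [RecF] using isRec_left S
  exact this.comp hf

@[fun_prop] theorem snd {f : α → β × γ} (hf : RecF S f) : RecF S (fun a => (f a).2) := by
  have : RecF S (Prod.snd : β × γ → γ) := by simpa [RecF] using isRec_right S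
  exact this.comp hf

@[fun_prop] theorem add {f g : α → M} (hf : RecF S f) (hg : RecF S g) :
    RecF S (fun a => f a + g a) := by
  have : RecF S (fun p : M × M => p.1 + p.2) := isRec_add S
  exact this.comp (hf.prodMk hg)

@[fun_prop] theorem mul {f g : α → M} (hf : RecF S f) (hg : RecF S g) :
    RecF S (fun a => f a * g a) := by
  have : RecF S (fun p : M × M => p.1 * p.2) := isRec_mul S
  exact this.comp (hf.prodMk hg)

@[fun_prop] theorem pair {f g : α → M} (hf : RecF S f) (hg : RecF S g) :
    RecF S (fun a => pair (f a) (g a)) := by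
  unfold SOA.pair
  fun_prop

end RecF

namespace RecP

theorem congr {M α : Type*} {S : Set (Set M)} [Coded S α] {P Q : α → Prop} (hP : RecP S P)
    (h : ∀ a, Q a ↔ P a) : RecP S Q :=
  (funext fun a => propext (h a) : Q = P) ▸ hP

@[fun_prop] theorem comp {P : β → Prop} {f : α → β} (hP : RecP S P) (hf : RecF S f) :
    RecP S (fun a => P (f a)) := by
  simpa [RecP] using IsRec.mem hf hP

@[fun_prop] theorem mem {A : Set M} (hA : A ∈ S) {f : α → M} (hf : RecF S f) :
    RecP S (fun a => f a ∈ A) :=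
  comp (P := (· ∈ A)) hA hf

@[fun_prop] theorem not {P : α → Prop} (hP : RecP S P) : RecP S (fun a => ¬ P a) :=
  compl_mem hP

@[fun_prop] theorem and {P Q : α → Prop} (hP : RecP S P) (hQ : RecP S Q) :
    RecP S (fun a => P a ∧ Q a) :=
  inter_mem hP hQ

@[fun_prop] theorem or {P Q : α → Prop} (hP : RecP S P) (hQ : RecP S Q) :
    RecP S (fun a => P a ∨ Q a) :=
  (hP.not.and hQ.not).not.congr fun a => by tauto

@[fun_prop] theorem imp {P Q : α → Prop} (hP : RecP S P) (hQ : RecP S Q) :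
    RecP S (fun a => P a → Q a) :=
  (hP.and hQ.not).not.congr fun a => by tauto

@[fun_prop] theorem iff {P Q : α → Prop} (hP : RecP S P) (hQ : RecP S Q) :
    RecP S (fun a => P a ↔ Q a) :=
  ((hP.imp hQ).and (hQ.imp hP)).congr fun a => by tauto

@[fun_prop] theorem lt {f g : α → M} (hf : RecF S f) (hg : RecF S g) :
    RecP S (fun a => f a < g a) := by
  have : RecP S (fun p : M × M => p.1 < p.2) := lt_mem S
  exact this.comp (hf.prodMk hg)

@[fun_prop] theorem le {f g : α → M} (hf : RecF S f) (hg : RecF S g) :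
    RecP S (fun a => f a ≤ g a) :=
  (lt hg hf).not.congr fun a => by simp

@[fun_prop] theorem eq {f g : α → β} (hf : RecF S f) (hg : RecF S g) :
    RecP S (fun a => f a = g a) := by
  have : RecP S (fun p : M × M => p.1 = p.2) := isRec_id S
  have h2 : RecF S (fun b : β => code S b) := by simpa [RecF] using isRec_id S
  exact (this.comp ((h2.comp hf).prodMk (h2.comp hg))).congr fun a => by simp

/-- Closure under bounded quantification. -/
@[fun_prop] theorem ball {P : α → M → Prop} {f : α → M} (hf : RecF S f)
    (hP : RecP S (fun p : α × M => P p.1 p.2)) : RecP S (fun a => ∀ x, x < f a → P a x) := by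
  have : RecP S (fun p : α × M => ∀ x, x < p.2 → P p.1 x) := by
    simpa [RecP] using forall_lt_mem hP
  exact this.comp ((RecF.id S).prodMk hf)

@[fun_prop] theorem bex {P : α → M → Prop} {f : α → M} (hf : RecF S f)
    (hP : RecP S (fun p : α × M => P p.1 p.2)) : RecP S (fun a => ∃ x, x < f a ∧ P a x) :=
  (ball (P := fun a x => ¬ P a x) hf hP.not).not.congr fun a => by simp

/-- Comprehension for `Δ⁰₁` predicates. -/
theorem delta {P : α → β → Prop} {Q : α → γ → Prop} (hP : RecP S (fun p : α × β => P p.1 p.2))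
    (hQ : RecP S (fun p : α × γ => Q p.1 p.2)) (h : ∀ a, (∃ b, P a b) ↔ ∀ b, Q a b) :
    RecP S (fun a => ∃ b, P a b) := by
  have := exists_mem_of_delta hP hQ (by
    intro n
    have := h ((code S).symm n)
    rw [(code S (α := β)).symm.surjective.exists,
      (code S (α := γ)).symm.surjective.forall] at this
    simpa using this)
  refine congr (P := fun a => ∃ m : M, P a ((code S).symm m)) (by simpa [RecP] using this)
    fun a => ?_
  rw [(code S (α := β)).symm.surjective.exists]

/-- Induction for `Σ⁰₁` predicates. -/
theorem sigma_induction {P : M → β → Prop} (hP : RecP S (fun p : M × β => P p.1 p.2))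
    (h0 : ∃ b, P 0 b) (hs : ∀ n b, P n b → ∃ b, P (n + 1) b) (n : M) : ∃ b, P n b := by
  have := induction_of_mem (S := S) hP
  simp only [Set.mem_ofPred_eq, code_prod_symm, left_natPair, right_natPair, code_self_symm,
    ← (code S (α := β)).symm.surjective.exists] at this
  exact this h0 (fun n ⟨b, hb⟩ => hs n b hb) n

theorem induction {P : M → Prop} (hP : RecP S P) (h0 : P 0) (hs : ∀ n, P n → P (n + 1)) (n : M) :
    P n := by
  have : RecP S (fun p : M × M => P p.1) := hP.comp (by fun_prop)
  obtain ⟨_, h⟩ := sigma_induction (P := fun n _ => P n) this ⟨0, h0⟩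
    (fun n _ h => ⟨0, hs n h⟩) n
  exact h

/-- The least number principle. -/
theorem exists_least {P : M → Prop} (hP : RecP S P) {n : M} (hn : P n) :
    ∃ m, P m ∧ ∀ x, x < m → ¬ P x := by
  by_contra h
  push Not at h
  have : ∀ n x, x < n → ¬ P x := by
    refine induction (S := S) (by fun_prop) (by simp) fun n ih x hx hPx => ?_
    rcases (Order.lt_add_one_iff.1 hx).lt_or_eq with hx | rfl
    · exact ih x hx hPx
    · obtain ⟨y, hy, hPy⟩ := h x hPx
      exact ih y hy hPy
  exact this (n + 1) n (lt_add_one n) hn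

end RecP

/-- A function whose graph is `Σ⁰₁` belongs to the model. -/
theorem RecF.of_sigma {f : α → β} {Q : α × β → γ → Prop}
    (hQ : RecP S (fun p : (α × β) × γ => Q p.1 p.2)) (h : ∀ a b, f a = b ↔ ∃ c, Q (a, b) c) :
    RecF S f := by
  have h1 : RecP S (fun p : (α × β) × (β × γ) => ¬ (Q (p.1.1, p.2.1) p.2.2 ∧ p.2.1 ≠ p.1.2)) :=
    (((hQ.comp (f := fun p : (α × β) × (β × γ) => ((p.1.1, p.2.1), p.2.2)) (by fun_prop))).and
      (RecP.not (by fun_prop))).not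
  have h2 := RecP.delta (S := S) (P := Q)
    (Q := fun p (q : β × γ) => ¬ (Q (p.1, q.1) q.2 ∧ q.1 ≠ p.2))
    hQ h1 (by
      rintro ⟨a, b⟩
      rw [← h]
      constructor
      · rintro rfl ⟨b', c⟩ ⟨h', h''⟩
        exact h'' ((h a b').2 ⟨c, h'⟩).symm
      · intro h'
        obtain ⟨c, hc⟩ := (h a (f a)).1 rfl
        by_contra hne
        exact h' (f a, c) ⟨hc, hne⟩)
  have h3 : RecP S (fun p : α × β => f p.1 = p.2) := h2.congr fun p => h p.1 p.2
  have h4 : {n : M | f ((code S).symm (left S n)) = (code S).symm (right S n)} ∈ S := h3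
  unfold RecF IsRec
  simpa only [Equiv.eq_symm_apply] using h4

theorem RecF.of_graph {f : α → β} (h : RecP S (fun p : α × β => f p.1 = p.2)) : RecF S f :=
  .of_sigma (Q := fun p _ => f p.1 = p.2) (γ := α)
    (h.comp (f := Prod.fst) (by fun_prop)) (fun a _ => ⟨fun h => ⟨a, h⟩, fun ⟨_, h⟩ => h⟩)

/-- Unbounded search: a choice function for a total relation of the model. -/
theorem exists_recF {P : α → M → Prop} (hP : RecP S (fun p : α × M => P p.1 p.2))
    (h : ∀ a, ∃ x, P a x) : ∃ f : α → M, RecF S f ∧ ∀ a, P a (f a) ∧ ∀ x, x < f a → ¬ P a x := by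
  have h1 : ∀ a, ∃ x, P a x ∧ ∀ y, y < x → ¬ P a y := fun a =>
    RecP.exists_least (hP.comp (f := fun x => (a, x)) (by fun_prop)) (h a).choose_spec
  choose f hf using h1
  refine ⟨f, .of_graph (RecP.congr (P := fun p : α × M => P p.1 p.2 ∧ ∀ y, y < p.2 → ¬ P p.1 y)
    ?_ ?_), hf⟩
  · refine hP.and (.ball (by fun_prop) (RecP.not ?_))
    exact hP.comp (f := fun p : (α × M) × M => (p.1.1, p.2)) (by fun_prop)
  · rintro ⟨a, x⟩
    change f a = x ↔ P a x ∧ ∀ y, y < x → ¬ P a y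
    constructor
    · rintro rfl; exact hf a
    · intro h
      rcases lt_trichotomy (f a) x with h' | h' | h'
      · exact absurd (hf a).1 (h.2 _ h')
      · exact h'
      · exact absurd h.1 ((hf a).2 _ h')

end Recursive

/-! ### Codes of finite sets -/

section FinSets

variable {M : Type*} [Numbers M]

theorem le_mul_self (a : M) : a ≤ a * a := by
  rcases eq_or_ne a 0 with rfl | h
  · exact zero_le
  · exact le_mul_of_one_le_left' (Order.one_le_iff_pos.2 (pos_iff_ne_zero.2 h))

theorem pair_injective {a b c d : M} (h : pair a b = pair c d) : a = c ∧ b = d := by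
  have bound : ∀ a b : M, pair a b < (a + b + 1) * (a + b + 1) := by
    intro a b
    have ha : (0 : M) ≤ a := zero_le
    have hb : (0 : M) ≤ b := zero_le
    rw [pair, sq_succ, Order.lt_add_one_iff]
    grind
  have hs : a + b = c + d :=
    sqrt_unique (n := pair a b) le_self_add (bound a b) (h ▸ le_self_add) (h ▸ bound c d)
  rw [pair, pair, hs] at h
  have h' : a = c := by grind
  exact ⟨h', by grind⟩

theorem pair_inj {a b c d : M} : pair a b = pair c d ↔ a = c ∧ b = d :=
  ⟨pair_injective, by rintro ⟨rfl, rfl⟩; rfl⟩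

theorem le_pair_left (a b : M) : a ≤ pair a b := le_add_self

theorem le_pair_right (a b : M) : b ≤ pair a b :=
  (le_add_self.trans (le_mul_self (a + b))).trans le_self_add

theorem finMem_pair {k m n i : M} :
    FinMem (pair k (pair m n)) i ↔ i < k ∧ m * (i + 1) + 1 ∣ n := by
  constructor
  · rintro ⟨k', m', n', h, hi, hq⟩
    rw [pair_inj, pair_inj] at h
    obtain ⟨rfl, rfl, rfl⟩ := h
    exact ⟨hi, hq⟩
  · exact fun h => ⟨k, m, n, rfl, h.1, h.2⟩

theorem FinMem.lt {c i : M} (h : FinMem c i) : i < c := by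
  obtain ⟨k, m, n, rfl, hi, -⟩ := h
  exact hi.trans_le (le_pair_left _ _)

theorem Entry.lt_left {s i x : M} (h : Entry s i x) : i < s := (le_pair_left i x).trans_lt h.lt

theorem Entry.lt_right {s i x : M} (h : Entry s i x) : x < s := (le_pair_right i x).trans_lt h.lt

theorem dvd_iff_exists_lt {a b : M} : a ∣ b ↔ ∃ q, q < b + 1 ∧ b = a * q := by
  constructor
  · rintro ⟨q, rfl⟩
    rcases eq_or_ne a 0 with rfl | ha
    · exact ⟨0, by simp⟩
    · exact ⟨q, Order.lt_add_one_iff.2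
        (le_mul_of_one_le_left' (Order.one_le_iff_pos.2 (pos_iff_ne_zero.2 ha))), rfl⟩
  · rintro ⟨q, -, h⟩; exact ⟨q, h⟩

theorem dvd_right_of_dvd_add {a x y : M} (h : a ∣ x + y) (hx : a ∣ x) : a ∣ y := by
  obtain ⟨p, hp⟩ := h
  obtain ⟨q, rfl⟩ := hx
  rcases le_total q p with h | h
  · obtain ⟨r, rfl⟩ := exists_add_of_le h
    rw [mul_add] at hp
    exact ⟨r, add_left_cancel hp⟩
  · have h1 : a * q + y ≤ a * q + 0 := by rw [add_zero, hp]; exact mul_le_mul_right h a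
    have h2 : y = 0 := by simpa using h1
    rw [h2]; exact dvd_zero a

/-- The numbers `m (i + 1) + 1` and `m (l + 1) + 1` are coprime if the difference of `i` and `l`
divides `m`. -/
theorem dvd_of_dvd_mul_modulus {m i l d n : M} (hd : d ∣ m) (h : l = i + d ∨ i = l + d)
    (hn : m * (i + 1) + 1 ∣ (m * (l + 1) + 1) * n) : m * (i + 1) + 1 ∣ n := by
  have coprime : ∀ x, m * (i + 1) + 1 ∣ m * x → m * (i + 1) + 1 ∣ x := by
    intro x hx
    refine dvd_right_of_dvd_add (x := (i + 1) * (m * x)) ?_ (hx.mul_left _)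
    exact ⟨x, by ring⟩
  have h1 : m * (i + 1) + 1 ∣ m * (d * n) := by
    rcases h with rfl | rfl
    · refine dvd_right_of_dvd_add (x := (m * (i + 1) + 1) * n) ?_ (dvd_mul_right _ _)
      convert hn using 1; ring
    · refine dvd_right_of_dvd_add ?_ hn
      exact ⟨n, by ring⟩
  obtain ⟨e, rfl⟩ := hd
  refine coprime _ (coprime _ ?_)
  convert h1.mul_left e using 1; ring

variable {S : Set (Set M)} [hS : RCA0 S] {α : Type*} [Coded S α]

@[fun_prop] theorem RecP.dvd {f g : α → M} (hf : RecF S f) (hg : RecF S g) :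
    RecP S (fun a => f a ∣ g a) :=
  RecP.congr (P := fun a => ∃ q, q < g a + 1 ∧ g a = f a * q) (by fun_prop)
    fun _ => dvd_iff_exists_lt

/-- Here and in the lemmas below, the unbounded quantifiers of a definition are bounded by the codes
involved, since a code is larger than every number of the coded set or sequence. -/
@[fun_prop] theorem RecP.finMem {f g : α → M} (hf : RecF S f) (hg : RecF S g) :
    RecP S (fun a => FinMem (f a) (g a)) := by
  have : RecP S (fun p : M × M => FinMem p.1 p.2) :=
    RecP.congr (P := fun p => ∃ k, k < p.1 + 1 ∧ ∃ m, m < p.1 + 1 ∧ ∃ n, n < p.1 + 1 ∧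
      (p.1 = SOA.pair k (SOA.pair m n) ∧ p.2 < k ∧ m * (p.2 + 1) + 1 ∣ n)) (by fun_prop) <| by
      rintro ⟨c, i⟩
      constructor
      · rintro ⟨k, m, n, rfl, h⟩
        simp only [Order.lt_add_one_iff]
        exact ⟨k, le_pair_left _ _, m, (le_pair_left _ _).trans (le_pair_right _ _), n,
          (le_pair_right _ _).trans (le_pair_right _ _), rfl, h⟩
      · rintro ⟨k, -, m, -, n, -, rfl, h⟩
        exact finMem_pair.2 h
  exact this.comp (hf.prodMk hg)

@[fun_prop] theorem RecP.entry {f g h : α → M} (hf : RecF S f) (hg : RecF S g) (hh : RecF S h) :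
    RecP S (fun a => Entry (f a) (g a) (h a)) := by
  unfold Entry
  fun_prop

@[fun_prop] theorem RecP.isFinSetCode {f : α → M} (hf : RecF S f) :
    RecP S (fun a => IsFinSetCode (f a)) := by
  have : RecP S (fun c : M => IsFinSetCode c) :=
    RecP.congr (P := fun c => ∀ c', c' < c → ¬ ∀ i, i < c → (FinMem c' i ↔ FinMem c i))
      (by fun_prop) <| by
      intro c
      refine forall₂_congr fun c' hc => not_congr ⟨fun h i _ => h i, fun h i => ?_⟩
      by_cases hi : i < c
      · exact h i hi
      · exact ⟨fun h => absurd (h.lt.trans hc) hi, fun h => absurd h.lt hi⟩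
  exact this.comp hf

@[fun_prop] theorem RecP.isSeq {f g : α → M} (hf : RecF S f) (hg : RecF S g) :
    RecP S (fun a => IsSeq (f a) (g a)) := by
  have : RecP S (fun p : M × M => IsSeq p.1 p.2) :=
    RecP.congr (P := fun a => IsFinSetCode a.1 ∧
      (∀ p, p < a.1 → FinMem a.1 p → ∃ i, i < a.2 ∧ ∃ x, x < a.1 ∧ p = SOA.pair i x) ∧
      ∀ i, i < a.2 → ∃ x, x < a.1 ∧ (Entry a.1 i x ∧ ∀ y, y < a.1 → Entry a.1 i y → y = x))
      (by fun_prop) <| by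
      rintro ⟨s, l⟩
      refine and_congr_right fun _ => and_congr ⟨fun h p _ hp => ?_, fun h p hp => ?_⟩
        ⟨fun h i hi => ?_, fun h i hi => ?_⟩
      · obtain ⟨i, x, hi, rfl⟩ := h p hp
        exact ⟨i, hi, x, (le_pair_right _ _).trans_lt hp.lt, rfl⟩
      · obtain ⟨i, hi, x, -, rfl⟩ := h p hp.lt hp
        exact ⟨i, x, hi, rfl⟩
      · obtain ⟨x, hx, hy⟩ := h i hi
        exact ⟨x, hx.lt_right, hx, fun y _ => hy y⟩
      · obtain ⟨x, -, hx, hy⟩ := h i hi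
        exact ⟨x, hx, fun y hy' => hy y hy'.lt_right hy'⟩
  exact this.comp (hf.prodMk hg)

theorem IsSeq.le {s l : M} (h : IsSeq s l) : l ≤ s := by
  by_contra hl
  obtain ⟨x, hx, -⟩ := h.2.2 s (not_le.1 hl)
  exact absurd hx.lt_left (lt_irrefl _)

@[fun_prop] theorem RecP.expands {f g : α → M} (hf : RecF S f) (hg : RecF S g) :
    RecP S (fun a => Expands (f a) (g a)) := by
  have : RecP S (fun p : M × M => Expands p.1 p.2) :=
    RecP.congr (P := fun a => ∃ l, l < a.2 + 1 ∧ (IsSeq a.2 l ∧ IsSeq a.1 (l + 1) ∧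
      ∀ i, i < l → ∀ x, x < a.1 + a.2 → (Entry a.1 i x ↔ Entry a.2 i x))) (by fun_prop) <| by
      rintro ⟨t, s⟩
      constructor
      · rintro ⟨l, h1, h2, h3⟩
        exact ⟨l, Order.lt_add_one_iff.2 h1.le, h1, h2, fun i hi x _ => h3 i hi x⟩
      · rintro ⟨l, -, h1, h2, h3⟩
        refine ⟨l, h1, h2, fun i hi x => ⟨fun h => ?_, fun h => ?_⟩⟩
        · exact (h3 i hi x (h.lt_right.trans_le le_self_add)).1 h
        · exact (h3 i hi x (h.lt_right.trans_le le_add_self)).2 h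
  exact this.comp (hf.prodMk hg)

@[fun_prop] theorem RecP.memH {r : M → M → Prop} (hr : RecP S (fun p : M × M => r p.1 p.2))
    {f : α → M} (hf : RecF S f) : RecP S (fun a => MemH r (f a)) := by
  have hr' : RecP S (fun p : ((((M × M) × M) × M) × M) × M => r p.2 p.1.2) :=
    hr.comp (f := fun p : ((((M × M) × M) × M) × M) × M => (p.2, p.1.2)) (by fun_prop)
  have : RecP S (fun s : M => MemH r s) :=
    RecP.congr (P := fun s => ∃ l, l < s + 1 ∧ (IsSeq s l ∧ ∀ i, i < s → ∀ j, j < l → ∀ x, x < s →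
      ∀ y, y < s → i < j → Entry s i x → Entry s j y → r y x)) (by fun_prop) <| by
      intro s
      constructor
      · rintro ⟨l, h1, h2⟩
        exact ⟨l, Order.lt_add_one_iff.2 h1.le, h1, fun i _ j hj x _ y _ hij => h2 i j x y hij hj⟩
      · rintro ⟨l, -, h1, h2⟩
        exact ⟨l, h1, fun i j x y hij hj hx hy =>
          h2 i hx.lt_left j hj x hx.lt_right y hy.lt_right hij hx hy⟩
  exact this.comp hf

/-- There is a common multiple of the numbers from `1` to `k`. -/
theorem exists_common_multiple (S : Set (Set M)) [RCA0 S] (k : M) :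
    ∃ m, 0 < m ∧ ∀ d, d < k → d + 1 ∣ m := by
  refine RecP.sigma_induction (S := S) (P := fun k m : M => 0 < m ∧ ∀ d, d < k → d + 1 ∣ m)
    (by fun_prop) ⟨1, by simp⟩ ?_ k
  rintro k m ⟨hm, h⟩
  refine ⟨m * (k + 1), mul_pos hm (by simp), fun d hd => ?_⟩
  rcases (Order.lt_add_one_iff.1 hd).lt_or_eq with hd | rfl
  · exact (h d hd).mul_right _
  · exact dvd_mul_left _ _

/-- Every bounded part of a set of the model is coded as a finite set. -/
theorem exists_finMem_iff {P : M → Prop} (hP : RecP S P) (k : M) :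
    ∃ c, ∀ i, FinMem c i ↔ i < k ∧ P i := by
  obtain ⟨m, hm, hdvd⟩ := exists_common_multiple S k
  have key : ∀ l, ∃ n, l ≤ k → ∀ i, i < k → (m * (i + 1) + 1 ∣ n ↔ i < l ∧ P i) := by
    refine RecP.sigma_induction (S := S)
      (P := fun l n => l ≤ k → ∀ i, i < k → (m * (i + 1) + 1 ∣ n ↔ i < l ∧ P i)) ?_ ⟨1, ?_⟩ ?_
    · fun_prop
    · intro _ i _
      have : ¬ m * (i + 1) + 1 ∣ 1 := by
        rintro ⟨q, hq⟩
        rcases eq_or_ne q 0 with rfl | hq0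
        · simp at hq
        · have h1 : (m * (i + 1) + 1) * 1 ≤ 1 := by
            conv_rhs => rw [hq]
            exact mul_le_mul' le_rfl (Order.one_le_iff_pos.2 (pos_iff_ne_zero.2 hq0))
          have h2 : 0 < m * (i + 1) := mul_pos hm (by simp)
          grind
      simp [this]
    · intro l n h
      by_cases hl : P l
      · refine ⟨(m * (l + 1) + 1) * n, fun hlk i hi => ?_⟩
        have ih := h (le_self_add.trans hlk) i hi
        have hl' : l < k := Order.add_one_le_iff.1 hlk
        rcases eq_or_ne i l with rfl | hne
        · simp [hl]
        · have h1 : m * (i + 1) + 1 ∣ (m * (l + 1) + 1) * n ↔ m * (i + 1) + 1 ∣ n := by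
            refine ⟨fun h => ?_, fun h => h.mul_left _⟩
            rcases lt_or_gt_of_ne hne with hlt | hlt
            · obtain ⟨d, rfl⟩ := exists_add_of_le (Order.add_one_le_iff.2 hlt)
              refine dvd_of_dvd_mul_modulus (hdvd d ?_) (Or.inl (by ring)) h
              exact lt_of_le_of_lt le_add_self hl'
            · obtain ⟨d, rfl⟩ := exists_add_of_le (Order.add_one_le_iff.2 hlt)
              refine dvd_of_dvd_mul_modulus (hdvd d ?_) (Or.inr (by ring)) h
              exact lt_of_le_of_lt le_add_self hi
          rw [h1, ih, Order.lt_add_one_iff]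
          constructor
          · exact fun h => ⟨h.1.le, h.2⟩
          · exact fun h => ⟨lt_of_le_of_ne h.1 hne, h.2⟩
      · refine ⟨n, fun hlk i hi => ?_⟩
        rw [h (le_self_add.trans hlk) i hi, Order.lt_add_one_iff]
        constructor
        · exact fun h => ⟨h.1.le, h.2⟩
        · rintro ⟨h1, h2⟩
          refine ⟨lt_of_le_of_ne h1 ?_, h2⟩
          rintro rfl
          exact hl h2
  obtain ⟨n, hn⟩ := key k
  refine ⟨pair k (pair m n), fun i => ?_⟩
  rw [finMem_pair]
  constructor
  · exact fun h => (hn le_rfl i h.1).1 h.2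
  · exact fun h => ⟨h.1, (hn le_rfl i h.1).2 h⟩

/-- The least code of a bounded part of a set of the model. -/
theorem exists_isFinSetCode {P : M → Prop} (hP : RecP S P) (k : M) :
    ∃ c, IsFinSetCode c ∧ ∀ i, FinMem c i ↔ i < k ∧ P i := by
  obtain ⟨c₀, h₀⟩ := exists_finMem_iff hP k
  have h1 : RecP S (fun c : M => ∀ i, FinMem c i ↔ FinMem c₀ i) :=
    RecP.congr (P := fun c => ∀ i, i < c + c₀ → (FinMem c i ↔ FinMem c₀ i)) (by fun_prop)
      fun c => ⟨fun h i _ => h i, fun h i =>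
        ⟨fun hi => (h i (hi.lt.trans_le le_self_add)).1 hi,
          fun hi => (h i (hi.lt.trans_le le_add_self)).2 hi⟩⟩
  obtain ⟨c, hc, hmin⟩ := RecP.exists_least h1 (n := c₀) fun _ => Iff.rfl
  exact ⟨c, fun c' hc' h => hmin c' hc' fun i => (h i).trans (hc i), fun i => (hc i).trans (h₀ i)⟩

theorem IsSeq.length_le {s l l' : M} (h : IsSeq s l) (h' : IsSeq s l') : l ≤ l' := by
  by_contra hl
  obtain ⟨x, hx, -⟩ := h.2.2 l' (not_le.1 hl)
  obtain ⟨i, y, hi, he⟩ := h'.2.1 _ hx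
  rw [pair_inj] at he
  exact absurd hi (he.1 ▸ lt_irrefl _)

theorem IsSeq.length_unique {s l l' : M} (h : IsSeq s l) (h' : IsSeq s l') : l = l' :=
  le_antisymm (h.length_le h') (h'.length_le h)

/-- The values of a function of the model on an initial segment are bounded. -/
theorem RecF.exists_bound {f : M → M} (hf : RecF S f) (n : M) : ∃ b, ∀ i, i < n → f i < b := by
  refine RecP.sigma_induction (S := S) (P := fun n b => ∀ i, i < n → f i < b) (by fun_prop)
    ⟨0, by simp⟩ ?_ n
  intro n b h
  refine ⟨b + f n + 1, fun i hi => ?_⟩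
  rw [Order.lt_add_one_iff]
  rcases (Order.lt_add_one_iff.1 hi).lt_or_eq with hi | rfl
  · exact (h i hi).le.trans le_self_add
  · exact le_add_self

/-- The code of the sequence of the first `n` values of a function of the model. -/
theorem RecF.exists_isSeq {f : M → M} (hf : RecF S f) (n : M) :
    ∃ s, IsSeq s n ∧ ∀ i x, Entry s i x ↔ i < n ∧ f i = x := by
  obtain ⟨b, hb⟩ := RecF.exists_bound (S := S) (f := fun i => SOA.pair i (f i)) (by fun_prop) n
  obtain ⟨s, hs, hmem⟩ := exists_isFinSetCode (S := S)
    (P := fun p => ∃ i, i < n ∧ p = SOA.pair i (f i)) (by fun_prop) b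
  have key : ∀ i x, Entry s i x ↔ i < n ∧ f i = x := by
    intro i x
    rw [Entry, hmem]
    constructor
    · rintro ⟨-, j, hj, he⟩
      rw [pair_inj] at he
      obtain ⟨rfl, rfl⟩ := he
      exact ⟨hj, rfl⟩
    · rintro ⟨hi, rfl⟩
      exact ⟨hb i hi, i, hi, rfl⟩
  refine ⟨s, ⟨hs, fun p hp => ?_, fun i hi => ⟨f i, (key _ _).2 ⟨hi, rfl⟩, ?_⟩⟩, key⟩
  · obtain ⟨-, i, hi, rfl⟩ := (hmem p).1 hp
    exact ⟨i, f i, hi, rfl⟩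
  · intro y hy
    exact ((key _ _).1 hy).2.symm

/-- Iteration of a function of the model. The graph of the iteration is `Σ⁰₁`: a pair belongs to it
iff it belongs to a coded finite set each of whose elements is justified by another one. -/
theorem RecF.exists_iterate {h : M → M} (hh : RecF S h) (a : M) :
    ∃ f : M → M, RecF S f ∧ f 0 = a ∧ ∀ n, f (n + 1) = h (f n) := by
  -- `c` codes a finite part of the graph: each of its elements is the initial one or comes from
  -- another element by one application of `h`
  let Closed : M → Prop := fun c => ∀ p, p < c → FinMem c p → p = SOA.pair 0 a ∨
    ∃ j, j < c ∧ ∃ z, z < c ∧ (FinMem c (SOA.pair j z) ∧ p = SOA.pair (j + 1) (h z))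
  have hClosed : RecP S Closed := by fun_prop
  have hQ : RecP S (fun p : (M × M) × M => Closed p.2 ∧ FinMem p.2 (SOA.pair p.1.1 p.1.2)) := by
    fun_prop
  have total : ∀ n, ∃ q : M × M, Closed q.2 ∧ FinMem q.2 (SOA.pair n q.1) := by
    refine RecP.sigma_induction (S := S)
      (P := fun n (q : M × M) => Closed q.2 ∧ FinMem q.2 (SOA.pair n q.1)) ?_ ?_ ?_
    · exact hQ.comp (f := fun p : M × (M × M) => ((p.1, p.2.1), p.2.2)) (by fun_prop)
    · obtain ⟨c, hc⟩ := exists_finMem_iff (S := S) (P := fun p => p = SOA.pair 0 a) (by fun_prop)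
        (SOA.pair 0 a + 1)
      exact ⟨(a, c), fun p _ hp => Or.inl ((hc p).1 hp).2, (hc _).2 ⟨lt_add_one _, rfl⟩⟩
    · rintro n ⟨y, c⟩ ⟨hc, hy⟩
      obtain ⟨c', hc'⟩ := exists_finMem_iff (S := S)
        (P := fun p => FinMem c p ∨ p = SOA.pair (n + 1) (h y)) (by fun_prop)
        (c + SOA.pair (n + 1) (h y) + 1)
      have sub : ∀ p, FinMem c p → FinMem c' p := fun p hp =>
        (hc' p).2 ⟨Order.lt_add_one_iff.2 (hp.lt.le.trans le_self_add), Or.inl hp⟩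
      refine ⟨(h y, c'), fun p _ hp => ?_,
        (hc' _).2 ⟨Order.lt_add_one_iff.2 le_add_self, Or.inr rfl⟩⟩
      have hjust : ∀ j z, FinMem c (SOA.pair j z) → p = SOA.pair (j + 1) (h z) →
          ∃ j, j < c' ∧ ∃ z, z < c' ∧ (FinMem c' (SOA.pair j z) ∧ p = SOA.pair (j + 1) (h z)) := by
        intro j z hjz hp
        have := (sub _ hjz)
        exact ⟨j, (le_pair_left _ _).trans_lt this.lt, z, (le_pair_right _ _).trans_lt this.lt,
          this, hp⟩
      rcases ((hc' p).1 hp).2 with hp | hp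
      · rcases hc p hp.lt hp with h0 | ⟨j, -, z, -, hjz, hp⟩
        · exact Or.inl h0
        · exact Or.inr (hjust j z hjz hp)
      · exact Or.inr (hjust n y hy hp)
  have closed_zero : ∀ c y, Closed c → FinMem c (SOA.pair 0 y) → y = a := by
    intro c y hc hy
    rcases hc _ hy.lt hy with h0 | ⟨j, -, z, -, -, he⟩
    · exact (pair_inj.1 h0).2
    · exact absurd (pair_inj.1 he).1.symm (by simp)
  have closed_succ : ∀ c n y, Closed c → FinMem c (SOA.pair (n + 1) y) →
      ∃ z, FinMem c (SOA.pair n z) ∧ y = h z := by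
    intro c n y hc hy
    rcases hc _ hy.lt hy with h0 | ⟨j, -, z, -, hjz, he⟩
    · exact absurd (pair_inj.1 h0).1 (by simp)
    · obtain ⟨h1, rfl⟩ := pair_inj.1 he
      obtain rfl := add_right_cancel h1
      exact ⟨z, hjz, rfl⟩
  have unique : ∀ c c', Closed c → Closed c' → ∀ n y y', FinMem c (SOA.pair n y) →
      FinMem c' (SOA.pair n y') → y = y' := by
    intro c c' hc hc' n
    have : ∀ n, ∀ y, y < c → ∀ y', y' < c' → FinMem c (SOA.pair n y) →
        FinMem c' (SOA.pair n y') → y = y' := by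
      refine RecP.induction (S := S) (by fun_prop) ?_ ?_
      · intro y _ y' _ hy hy'
        rw [closed_zero c y hc hy, closed_zero c' y' hc' hy']
      · intro n ih y _ y' _ hy hy'
        obtain ⟨z, hz, rfl⟩ := closed_succ c n y hc hy
        obtain ⟨z', hz', rfl⟩ := closed_succ c' n y' hc' hy'
        rw [ih z ((le_pair_right _ _).trans_lt hz.lt) z' ((le_pair_right _ _).trans_lt hz'.lt)
          hz hz']
    intro y y' hy hy'
    exact this n y ((le_pair_right _ _).trans_lt hy.lt) y' ((le_pair_right _ _).trans_lt hy'.lt)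
      hy hy'
  choose f hf using total
  have graph : ∀ n y c, Closed c → FinMem c (SOA.pair n y) → (f n).1 = y := fun n y c hc hy =>
    unique _ c (hf n).1 hc n _ y (hf n).2 hy
  refine ⟨fun n => (f n).1,
    .of_sigma (Q := fun p c => Closed c ∧ FinMem c (SOA.pair p.1 p.2)) hQ fun n y => ?_,
    closed_zero _ _ (hf 0).1 (hf 0).2, fun n => ?_⟩
  · constructor
    · rintro rfl; exact ⟨(f n).2, hf n⟩
    · rintro ⟨c, hc, hy⟩; exact graph n y c hc hy
  · obtain ⟨z, hz, he⟩ := closed_succ _ n _ (hf (n + 1)).1 (hf (n + 1)).2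
    change (f (n + 1)).1 = h (f n).1
    rw [he, graph n z _ (hf (n + 1)).1 hz]

end FinSets

/-! ### H-well-foundedness in terms of infinite chains -/

section Chains

variable {M : Type*} [Numbers M] {S : Set (Set M)} [hS : RCA0 S]

theorem IsFun.exists_recF {F : Set M} (hF : F ∈ S) (h : IsFun F) :
    ∃ f : M → M, RecF S f ∧ ∀ n, pair n (f n) ∈ F := by
  obtain ⟨f, hf, hf'⟩ := SOA.exists_recF (S := S) (P := fun n x => pair n x ∈ F) (by fun_prop)
    fun n => (h.2 n).exists
  exact ⟨f, hf, fun n => (hf' n).1⟩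

theorem RecF.exists_isFun {f : M → M} (hf : RecF S f) :
    ∃ F ∈ S, IsFun F ∧ ∀ n x, SOA.pair n x ∈ F ↔ f n = x := by
  have hF : RecP S (fun p : M => ∃ n, n < p + 1 ∧ p = SOA.pair n (f n)) := by fun_prop
  have key : ∀ n x, SOA.pair n x ∈ {p : M | ∃ n, n < p + 1 ∧ p = SOA.pair n (f n)} ↔ f n = x := by
    intro n x
    constructor
    · rintro ⟨m, -, h⟩
      obtain ⟨rfl, rfl⟩ := pair_inj.1 h
      rfl
    · rintro rfl
      exact ⟨n, Order.lt_add_one_iff.2 (le_pair_left _ _), rfl⟩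
  refine ⟨_, hF, ⟨?_, fun n => ⟨f n, (key _ _).2 rfl, fun x hx => ((key _ _).1 hx).symm⟩⟩, key⟩
  rintro p ⟨n, -, h⟩
  exact ⟨n, _, h⟩

/-- A function of the model that increases at each step is strictly increasing; this takes an
induction in the model. -/
theorem RecF.strictMono {f : M → M} (hf : RecF S f) (h : ∀ n, f n < f (n + 1)) : StrictMono f := by
  intro i j hij
  obtain ⟨d, rfl⟩ := exists_add_of_le (Order.add_one_le_iff.2 hij)
  refine RecP.induction (S := S) (P := fun d => f i < f (i + 1 + d)) (by fun_prop) ?_ ?_ d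
  · rw [add_zero]; exact h i
  · intro d hd
    rw [← add_assoc]
    exact hd.trans (h _)

theorem IsSeq.entry_iff {s n : M} {g : M → M} (hs : IsSeq s n) (hg : ∀ i, i < n → Entry s i (g i))
    {i x : M} (hi : i < n) : Entry s i x ↔ x = g i :=
  ⟨fun h => (hs.2.2 i hi).unique h (hg i hi), by rintro rfl; exact hg i hi⟩

/-- An infinite chain for `r` gives, by its initial segments, an infinite branch of `H(r)`. -/
theorem exists_branch {r : M → M → Prop} {g : M → M} (hg : RecF S g)
    (hr : ∀ i j, i < j → r (g j) (g i)) :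
    ∃ f : M → M, RecF S f ∧ ∀ n, IsSeq (f n) n ∧ MemH r (f n) ∧ Expands (f (n + 1)) (f n) := by
  obtain ⟨f, hf, hf'⟩ := exists_recF (S := S)
    (P := fun n s => IsSeq s n ∧ ∀ i, i < n → Entry s i (g i)) (by fun_prop) fun n => by
      obtain ⟨s, hs, he⟩ := hg.exists_isSeq n
      exact ⟨s, hs, fun i hi => (he _ _).2 ⟨hi, rfl⟩⟩
  have h1 : ∀ n, IsSeq (f n) n := fun n => (hf' n).1.1
  have h2 : ∀ n i x, i < n → (Entry (f n) i x ↔ x = g i) := fun n i x hi =>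
    (h1 n).entry_iff (hf' n).1.2 hi
  refine ⟨f, hf, fun n => ⟨h1 n, ⟨n, h1 n, fun i j x y hij hj hx hy => ?_⟩,
    n, h1 n, h1 (n + 1), fun i hi x => ?_⟩⟩
  · rw [h2 n i x (hij.trans hj)] at hx
    rw [h2 n j y hj] at hy
    rw [hx, hy]
    exact hr i j hij
  · rw [h2 n i x hi, h2 (n + 1) i x (hi.trans (lt_add_one n))]

/-- An infinite branch of `H(r)` gives an infinite chain for `r`: the `i`-th element of the chain
is the entry of index `i` that is common to almost all sequences of the branch. -/
theorem exists_chain {r : M → M → Prop} {f : M → M} (hf : RecF S f) (hH : ∀ n, MemH r (f n))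
    (hE : ∀ n, Expands (f (n + 1)) (f n)) :
    ∃ g : M → M, RecF S g ∧ ∀ i j, i < j → r (g j) (g i) := by
  obtain ⟨l, hl, -⟩ := hH 0
  have hlen : ∀ n, IsSeq (f n) (l + n) := by
    refine RecP.induction (S := S) (by fun_prop) (by simpa using hl) fun n ih => ?_
    obtain ⟨l', h1, h2, -⟩ := hE n
    rw [← add_assoc, ih.length_unique h1]
    exact h2
  have hstep : ∀ n i x, i < l + n → Entry (f n) i x → Entry (f (n + 1)) i x := by
    intro n i x hi hx
    obtain ⟨l', h1, -, h3⟩ := hE n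
    rw [(hlen n).length_unique h1] at hi
    exact (h3 i hi x).2 hx
  have hpersist : ∀ n i x, i < l + n → Entry (f n) i x → ∀ d, Entry (f (n + d)) i x := by
    intro n i x hi hx
    refine RecP.induction (S := S) (by fun_prop) (by simpa using hx) fun d ih => ?_
    rw [← add_assoc]
    refine hstep _ _ _ (hi.trans_le ?_) ih
    rw [← add_assoc]
    exact le_self_add
  have hlt : ∀ i, i < l + (i + 1) := fun i => (lt_add_one i).trans_le le_add_self
  obtain ⟨g, hg, hg'⟩ := exists_recF (S := S) (P := fun i x => Entry (f (i + 1)) i x)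
    (by fun_prop) fun i => ((hlen (i + 1)).2.2 i (hlt i)).exists
  refine ⟨g, hg, fun i j hij => ?_⟩
  obtain ⟨d, rfl⟩ := exists_add_of_le (Order.add_one_le_iff.2 hij)
  obtain ⟨l', h1, h2⟩ := hH (i + 1 + d + 1)
  refine h2 i (i + 1 + d) _ _ hij ?_ ?_ (hg' _).1
  · rw [h1.length_unique (hlen _)]; exact hlt _
  · rw [add_assoc (i + 1)]
    exact hpersist _ _ _ (hlt i) (hg' i).1 _

/-- A relation is H-well-founded iff it has no infinite chain. -/
theorem hWellFounded_iff {r : M → M → Prop} :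
    HWellFounded S r ↔ ¬ ∃ g : M → M, RecF S g ∧ ∀ i j, i < j → r (g j) (g i) := by
  refine not_congr ⟨?_, ?_⟩
  · rintro ⟨F, hF, hfun, hH, hE⟩
    obtain ⟨f, hf, hfF⟩ := hfun.exists_recF hF
    exact exists_chain hf (fun n => hH n _ (hfF n)) fun n => hE n _ _ (hfF n) (hfF (n + 1))
  · rintro ⟨g, hg, hr⟩
    obtain ⟨f, hf, h⟩ := exists_branch hg hr
    obtain ⟨F, hF, hfun, hfF⟩ := hf.exists_isFun
    refine ⟨F, hF, hfun, fun n s hs => ?_, fun n s t hs ht => ?_⟩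
    · rw [hfF] at hs
      exact hs ▸ (h n).2.1
    · rw [hfF] at hs ht
      exact hs ▸ ht ▸ (h n).2.2

/-- For a relation of the model, the inductive and the classical form of H-well-foundedness are
equivalent. The complement of a branch is inductive; and if an inductive set omits an element of
`H(r)`, then each omitted element has an omitted expansion, so that iterated search for the least
one yields a branch. -/
theorem indHWellFounded_iff {r : M → M → Prop} (hr : RecP S (fun p : M × M => r p.1 p.2)) :
    IndHWellFounded S r ↔ HWellFounded S r := by
  constructor
  · rw [hWellFounded_iff]
    rintro hind ⟨g, hg, hgr⟩
    obtain ⟨f, hf, h⟩ := exists_branch hg hgr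
    have hX : RecP S (fun s : M => ¬ ∃ n, n < s + 1 ∧ f n = s) := by fun_prop
    refine hind _ hX (fun s _ hs => ?_) (f 0) (h 0).2.1 ⟨0, by simp, rfl⟩
    rintro ⟨n, -, rfl⟩
    exact hs (f (n + 1)) (h (n + 1)).2.1 (h n).2.2
      ⟨n + 1, Order.lt_add_one_iff.2 (h (n + 1)).1.le, rfl⟩
  · intro hwf X hX hind s hs
    by_contra hsX
    have hD : RecP S (fun s : M => MemH r s ∧ ¬ s ∈ X) := by fun_prop
    obtain ⟨h, hh, hh'⟩ := exists_recF (S := S) (P := fun s t => MemH r s ∧ ¬ s ∈ X →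
      (MemH r t ∧ ¬ t ∈ X) ∧ Expands t s) (by fun_prop) (by
        intro s
        by_cases hs : MemH r s ∧ ¬ s ∈ X
        · by_contra hne
          push Not at hne
          refine hs.2 (hind s hs.1 fun t ht hts => ?_)
          by_contra htX
          exact (hne t).2 ⟨ht, htX⟩ hts
        · exact ⟨0, fun h => absurd h hs⟩)
    obtain ⟨f, hf, h0, hsucc⟩ := hh.exists_iterate s
    have hf' : ∀ n, MemH r (f n) ∧ ¬ f n ∈ X := by
      refine RecP.induction (S := S) (hD.comp hf) (h0 ▸ ⟨hs, hsX⟩) fun n ih => ?_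
      rw [hsucc]
      exact ((hh' (f n)).1 ih).1
    refine hWellFounded_iff.1 hwf (exists_chain hf (fun n => (hf' n).1) fun n => ?_)
    rw [hsucc]
    exact ((hh' (f n)).1 (hf' n)).2

@[fun_prop] theorem RecP.relAt {α : Type*} [Coded S α] {R : Set M} (hR : R ∈ S) {f g h : α → M}
    (hf : RecF S f) (hg : RecF S g) (hh : RecF S h) :
    RecP S (fun a => relAt R (f a) (g a) (h a)) := by
  unfold SOA.relAt
  fun_prop

theorem indHClosure_iff (k : M) : IndHClosure S k ↔ HClosure S k := by
  refine forall₂_congr fun R hR => ?_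
  have h1 : ∀ i, RecP S (fun p : M × M => relAt R i p.1 p.2) := fun i => by fun_prop
  have h2 : RecP S (fun p : M × M => unionRel R k p.1 p.2) := by
    unfold unionRel
    fun_prop
  rw [indHWellFounded_iff h2]
  exact imp_congr_left (forall₂_congr fun i _ => indHWellFounded_iff (h1 i))

end Chains

/-! ### H-closure and Ramsey's theorem for pairs -/

section Ramsey

variable {M : Type*} [Numbers M] {S : Set (Set M)} [hS : RCA0 S]

theorem IsColouring.lt {P : Set M} {k x y c : M} (hP : IsColouring P k)
    (h : pair (pair x y) c ∈ P) : c < k := by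
  obtain ⟨x', y', c', -, hc, he⟩ := hP.1 _ h
  exact (pair_inj.1 he).2 ▸ hc

/-- The relations `x < y ∧ P(x, y) = i` have the order `>` as their union, and an infinite chain
for one of them is an infinite homogeneous set. -/
theorem RT2.of_hClosure {k : M} (h : HClosure S k) : RT2 S k := by
  intro P hP hcol
  by_contra hno
  let R : Set M := {q | ∃ x, x < q + 1 ∧ ∃ y, y < q + 1 ∧ ∃ c, c < q + 1 ∧
    (q = pair (pair y x) c ∧ x < y ∧ pair (pair x y) c ∈ P)}
  have hR : R ∈ S := by
    have : RecP S (fun q : M => ∃ x, x < q + 1 ∧ ∃ y, y < q + 1 ∧ ∃ c, c < q + 1 ∧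
      (q = pair (pair y x) c ∧ x < y ∧ pair (pair x y) c ∈ P)) := by fun_prop
    exact this
  have hrel : ∀ c y x, relAt R c y x ↔ x < y ∧ pair (pair x y) c ∈ P := by
    intro c y x
    constructor
    · rintro ⟨x', -, y', -, c', -, he, h'⟩
      obtain ⟨hxy, rfl⟩ := pair_inj.1 he
      obtain ⟨rfl, rfl⟩ := pair_inj.1 hxy
      exact h'
    · intro h'
      simp only [relAt, R, Set.mem_ofPred_eq, Order.lt_add_one_iff]
      exact ⟨x, (le_pair_right _ _).trans (le_pair_left _ _), y,
        (le_pair_left _ _).trans (le_pair_left _ _), c, le_pair_right _ _, rfl, h'⟩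
  refine hWellFounded_iff.1 (h R hR fun c hc => hWellFounded_iff.2 ?_)
    ⟨fun n => n, RecF.id S, fun i j hij => ?_⟩
  · rintro ⟨g, hg, hgr⟩
    simp only [hrel] at hgr
    have hmono : StrictMono g := fun i j hij => (hgr i j hij).1
    have hle : ∀ n, n ≤ g n := by
      refine RecP.induction (S := S) (by fun_prop) zero_le fun n ih => ?_
      exact Order.add_one_le_of_lt (ih.trans_lt (hmono (lt_add_one n)))
    have hH : RecP S (fun x : M => ∃ i, i < x + 1 ∧ g i = x) := by fun_prop
    refine hno ⟨_, hH, fun n => ⟨g (n + 1), ⟨n + 1, Order.lt_add_one_iff.2 (hle _), rfl⟩,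
      Order.add_one_le_iff.1 (hle (n + 1))⟩, c, hc, ?_⟩
    rintro _ ⟨i, -, rfl⟩ _ ⟨j, -, rfl⟩ hij
    exact (hgr i j (hmono.lt_iff_lt.1 hij)).2
  · obtain ⟨c, hc, -⟩ := hcol.2 i j hij
    exact ⟨c, hcol.lt hc, (hrel _ _ _).2 ⟨hij, hc⟩⟩

/-- A chain `g` for the union of the relations `R i` colours the pairs `i < j` by the least `c`
with `g j R c g i`; along an infinite homogeneous set, `g` is a chain for a single relation. -/
theorem RT2.hClosure {k : M} (h : RT2 S k) : HClosure S k := by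
  intro R hR hwf
  rw [hWellFounded_iff]
  rintro ⟨g, hg, hgr⟩
  obtain ⟨col, hcol, hcol'⟩ := exists_recF (S := S)
    (P := fun (p : M × M) c => p.1 < p.2 → (c < k ∧ relAt R c (g p.2) (g p.1))) (by fun_prop) (by
      rintro ⟨i, j⟩
      by_cases hij : i < j
      · obtain ⟨c, hc⟩ := hgr i j hij
        exact ⟨c, fun _ => hc⟩
      · exact ⟨0, fun h => absurd h hij⟩)
  let P : Set M := {p | ∃ x, x < p + 1 ∧ ∃ y, y < p + 1 ∧
    (x < y ∧ p = pair (pair x y) (col (x, y)))}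
  have hP : P ∈ S := by
    have : RecP S (fun p : M => ∃ x, x < p + 1 ∧ ∃ y, y < p + 1 ∧
      (x < y ∧ p = pair (pair x y) (col (x, y)))) := by fun_prop
    exact this
  have hmem : ∀ x y c, pair (pair x y) c ∈ P ↔ x < y ∧ c = col (x, y) := by
    intro x y c
    constructor
    · rintro ⟨x', -, y', -, hlt, he⟩
      obtain ⟨hxy, rfl⟩ := pair_inj.1 he
      obtain ⟨rfl, rfl⟩ := pair_inj.1 hxy
      exact ⟨hlt, rfl⟩
    · rintro ⟨hlt, rfl⟩
      simp only [P, Set.mem_ofPred_eq, Order.lt_add_one_iff]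
      exact ⟨x, (le_pair_left _ _).trans (le_pair_left _ _), y,
        (le_pair_right _ _).trans (le_pair_left _ _), hlt, rfl⟩
  have hPcol : IsColouring P k := by
    refine ⟨?_, fun x y hxy => ⟨col (x, y), (hmem _ _ _).2 ⟨hxy, rfl⟩,
      fun c hc => ((hmem _ _ _).1 hc).2⟩⟩
    rintro p ⟨x, -, y, -, hlt, rfl⟩
    exact ⟨x, y, _, hlt, ((hcol' (x, y)).1 hlt).1, rfl⟩
  obtain ⟨H, hH, hinf, c, hc, hhom⟩ := h P hP hPcol
  -- the increasing enumeration of `H`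
  obtain ⟨next, hnext, hnext'⟩ := exists_recF (S := S) (P := fun n m => m ∈ H ∧ n < m)
    (by fun_prop) hinf
  obtain ⟨e, he, he0, hesucc⟩ := hnext.exists_iterate (next 0)
  have heH : ∀ n, e n ∈ H := by
    refine RecP.induction (S := S) (by fun_prop) (he0 ▸ (hnext' 0).1.1) fun n _ => ?_
    rw [hesucc]
    exact (hnext' _).1.1
  have hemono : StrictMono e := he.strictMono fun n => by
    rw [hesucc]
    exact (hnext' _).1.2
  refine hWellFounded_iff.1 (hwf c hc) ⟨fun n => g (e n), by fun_prop, fun i j hij => ?_⟩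
  have hlt := hemono hij
  rw [((hmem _ _ _).1 (hhom _ (heH i) _ (heH j) hlt)).2]
  exact ((hcol' (e i, e j)).1 hlt).2

end Ramsey
end SOA

/-- In every model `(M, S)` of RCA₀ and for every number `k` of the model, H-closure for `k`
relations in its inductive and in its classical form and Ramsey's theorem for pairs in `k` colours
are equivalent. -/
theorem mainTheorem1 {M : Type*} [Zero M] [One M] [Add M] [Mul M] [LT M] (S : Set (Set M))
    (hS : SOA.ModelsRCA0 S) (k : M) :
    [SOA.IndHClosure S k, SOA.HClosure S k, SOA.RT2 S k].TFAE := by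
  let _ : SOA.Numbers M := hS.numbers
  have _ : SOA.RCA0 S := ⟨hS⟩
  tfae_have 1 ↔ 2 := SOA.indHClosure_iff k
  tfae_have 2 → 3 := SOA.RT2.of_hClosure
  tfae_have 3 → 2 := SOA.RT2.hClosure
  tfae_finish
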